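/- A weight function is a continuous increasing (i.e. non-decreasing) function $\omega:[0,\infty)\to[0,\infty)$ such that: ($\alpha$) there is $K\ge 1$ with $\omega(2x)\le K(1+\omega(x))$ for all $x\ge0$; ($\beta$) $\omega(x)=o(x)$ as $x\to\infty$; ($\gamma$) there are $a\in\mathbb{R}$, $b>0$ with $\omega(x)\ge a+b\log(1+x)$ for all $x\ge 0$; ($\delta$) $t\mapsto\omega(e^t)$ is convex on $\mathbb{R}$. Its Young conjugate is $\varphi^*_\omega(s)=\sup_{t\ge0}\{ts-\omega(e^t)\}\in(-\infty,\infty]$, $s\ge0$. Let $\omega_1,\dots,\omega_N,\sigma_1,\dots,\sigma_N$ be weight functions and put, for $x\in\mathbb{R}^N$ and $y\in[0,\infty)^N$, $$\Omega(x)=\sum_{j=1}^N\omega_j(|x_j|),\quad \Sigma(x)=\sum_{j=1}^N\sigma_j(|x_j|),\quad \Omega^*(y)=\sum_{j=1}^N\varphi^*_{\omega_j}(y_j),\quad \Sigma^*(y)=\sum_{j=1}^N\varphi^*_{\sigma_j}(y_j).$$ Write $\hat f(\xi)=\int_{\mathbb{R}^N}e^{-ix\cdot\xi}f(x)\,dx$,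 $D^\alpha=(-i)^{|\alpha|}\partial^\alpha$, and $\exp(-\infty)=0$. Let $\mathcal{S}^\Sigma_\Omega(\mathbb{R}^N)$ be the set of all $f\in L^1(\mathbb{R}^N)$ such that $f,\hat f\in C^\infty(\mathbb{R}^N)$ and, for all $\lambda>0$ and $\alpha\in\mathbb{N}_0^N$, $\|\exp(\lambda\Omega)D^\alpha f\|_\infty<\infty$ and $\|\exp(\lambda\Sigma)D^\alpha\hat f\|_\infty<\infty$. **Theorem.** Let $f\in\mathcal{S}(\mathbb{R}^N)$ and $1\le p,q\le\infty$. The following conditions are equivalent. 1. $f\in\mathcal{S}^\Sigma_\Omega(\mathbb{R}^N)$. 2. $\|\exp(\lambda\Omega)D^\alpha f\|_p<\infty$ and $\|\exp(\lambda\Sigma)D^\alpha\hat f\|_q<\infty$ for all $\lambda>0$ and $\alpha\in\mathbb{N}_0^N$. 3. $\|\exp(\lambda\Omega) f\|_p<\infty$ and $\|\exp(\lambda\Sigma)\hat f\|_q<\infty$ for all $\lambda>0$. 4. $\|\exp(\lambda\Omega)x^\alpha f\|_p<\infty$ and $\|\exp(\lambda\Sigma)\xi^\alpha\hat f\|_q<\infty$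 for all $\lambda>0$ and $\alpha\in\mathbb{N}_0^N$. 5. Both of the following hold: (a) for each $\lambda>0$ and $\beta\in\mathbb{N}_0^N$ there is $C_{\beta,\lambda}>0$ such that for every $\alpha\in\mathbb{N}_0^N$ $$\left\|\exp\left(-\lambda\Sigma^*\left(\tfrac{\alpha}{\lambda}\right)\right)x^\beta D^\alpha f\right\|_p\le C_{\beta,\lambda};$$ (b) for each $\mu>0$ and $\alpha\in\mathbb{N}_0^N$ there is $C_{\alpha,\mu}>0$ such that for every $\beta\in\mathbb{N}_0^N$ $$\left\|\exp\left(-\mu\Omega^*\left(\tfrac{\beta}{\mu}\right)\right)x^\beta D^\alpha f\right\|_q\le C_{\alpha,\mu}.$$ 6. For each $\lambda,\mu>0$ there is $C_{\mu,\lambda}>0$ such that for all $\alpha,\beta\in\mathbb{N}_0^N$ $$\left\|\exp\left(-\lambda\Sigma^*\left(\tfrac{\alpha}{\lambda}\right)-\mu\Omega^*\left(\tfrac{\beta}{\mu}\right)\right)x^\beta D^\alpha f\right\|_p\le C_{\mu,\lambda}.$$ -/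

import Mathlib

open MeasureTheory Filter
open scoped ENNReal SchwartzMap

noncomputable section

/-- `ω`, restricted to `[0, ∞)`, is a weight function. Only the values of `ω` on `[0, ∞)` are ever
used; the extension to the whole line is `x ↦ ω |x|`. -/
structure IsWeightFunction (ω : ℝ → ℝ) : Prop where
  continuousOn : ContinuousOn ω (Set.Ici 0)
  monotoneOn : MonotoneOn ω (Set.Ici 0)
  nonneg : ∀ x : ℝ, 0 ≤ x → 0 ≤ ω x
  doubling : ∃ K : ℝ, 1 ≤ K ∧ ∀ x : ℝ, 0 ≤ x → ω (2 * x) ≤ K * (1 + ω x)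
  isLittleO_id : ω =o[atTop] (fun x : ℝ => x)
  log_le : ∃ a b : ℝ, 0 < b ∧ ∀ x : ℝ, 0 ≤ x → a + b * Real.log (1 + x) ≤ ω x
  convex_comp_exp : ConvexOn ℝ Set.univ (fun t : ℝ => ω (Real.exp t))

/-- The weight `ω₁ ⊕ ⋯ ⊕ ω_N` on `ℝ^N`, `x ↦ ω₁(|x₁|) + ⋯ + ω_N(|x_N|)`. -/
def sumWeight {N : ℕ} (ω : Fin N → ℝ → ℝ) (x : EuclideanSpace ℝ (Fin N)) : ℝ :=
  ∑ j, ω j |x j|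

/-- The Young conjugate `φ*(s) = sup_{t ≥ 0} (t s - ω(e^t))`, with values in `(-∞, ∞]`: the value
`∞` does occur, for instance for `ω(x) = log (1 + x)` and `s > 1`. -/
def youngConj (ω : ℝ → ℝ) (s : ℝ) : EReal :=
  ⨆ t ∈ Set.Ici (0 : ℝ), ((t * s - ω (Real.exp t) : ℝ) : EReal)

/-- `y ↦ φ*_{ω₁}(y₁) + ⋯ + φ*_{ω_N}(y_N)`, for `y` with nonnegative entries. -/
def sumYoungConj {N : ℕ} (ω : Fin N → ℝ → ℝ) (y : Fin N → ℝ) : EReal :=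
  ∑ j, youngConj (ω j) (y j)

/-- The exponential on `[-∞, ∞)`, with `exp (-∞) = 0` (it is never used at `+∞`). -/
def expE (a : EReal) : ℝ := (EReal.exp a).toReal

/-- The monomial `x^β`. -/
def monomialFun {N : ℕ} (β : Fin N → ℕ) (x : EuclideanSpace ℝ (Fin N)) : ℝ :=
  ∏ j, x j ^ β j

/-- `D^α f = (-i)^{|α|} ∂^α f`: the derivative of order `|α|` is evaluated at the tuple that
contains the `j`-th standard basis vector exactly `α j` times, for each `j`. -/
def multiDeriv {N : ℕ} (α : Fin N → ℕ) (f : EuclideanSpace ℝ (Fin N) → ℂ)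
    (x : EuclideanSpace ℝ (Fin N)) : ℂ :=
  (-Complex.I) ^ (∑ j, α j) *
    iteratedFDeriv ℝ (∑ j, α j) f x
      (fun i => EuclideanSpace.single (finSigmaFinEquiv.symm i).1 (1 : ℝ))

/-- The Fourier transform `∫ e^{-i x·ξ} f(x) dx`. -/
def fourierHat {N : ℕ} (f : EuclideanSpace ℝ (Fin N) → ℂ) (ξ : EuclideanSpace ℝ (Fin N)) : ℂ :=
  ∫ x, Complex.exp (-Complex.I * (inner ℝ x ξ : ℝ)) * f x

/-- The space `S^Σ_Ω(ℝ^N)` with `Ω = ω₁ ⊕ ⋯ ⊕ ω_N` and `Σ = σ₁ ⊕ ⋯ ⊕ σ_N`. -/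
def ultraSpace {N : ℕ} (ω σ : Fin N → ℝ → ℝ) : Set (EuclideanSpace ℝ (Fin N) → ℂ) :=
  {f | Integrable f volume ∧ ContDiff ℝ ((⊤ : ℕ∞) : WithTop ℕ∞) f ∧ ContDiff ℝ ((⊤ : ℕ∞) : WithTop ℕ∞) (fourierHat f) ∧
    (∀ r : ℝ, 0 < r → ∀ α : Fin N → ℕ,
      eLpNorm (fun x => (Real.exp (r * sumWeight ω x) : ℂ) * multiDeriv α f x) ∞ volume < ∞) ∧
    (∀ r : ℝ, 0 < r → ∀ α : Fin N → ℕ,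
      eLpNorm (fun ξ => (Real.exp (r * sumWeight σ ξ) : ℂ) * multiDeriv α (fourierHat f) ξ)
        ∞ volume < ∞)}

end

/-! Every condition is equivalent to rapid decay: `f` is O(exp(-rΩ)) and its Fourier transform is
O(exp(-rΣ)) for all r > 0, with no derivatives or monomials involved.

The exponents p, q do not matter. Condition (γ) makes exp(cΩ) dominate a polynomial weight whose
inverse lies in every L^p, so pointwise decay gives L^p bounds, and Hölder turns L^p bounds into L^1
bounds. Since `f` is Lipschitz, a large value persists on a ball, so weighted L^1 bounds give back
pointwise decay (`rapidDecay_of_integrable`). Derivatives inherit decay by a Landau-type difference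
quotient (`RapidDecay.lineDerivOp`); monomials are absorbed by the weight.

The Young conjugate links weights to powers in two ways. Testing the supremum gives exp(-rφ*(n/r))
uⁿ ≤ C exp(rω(u)); a subgradient of ω(e^t) gives, for each u, an n for which the reverse holds after
changing r, with a spare factor e^{-n} (`IsWeightFunction.exp_le_expE_youngConj_mul_pow`). Combined
with |ξ^α f^(ξ)| ≤ ‖D^α f‖₁ and a summation over β, the reverse estimate recovers rapid decay from
(5).

The mixed estimate (6) needs simultaneous control of x and α. The Gaussian short-time Fourier
transform V(x, ξ) decays in x because `f` does and in ξ because 𝓕f does, hence in both by taking a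
geometric mean. Inverting it and writing the reciprocal Gaussian as an integral of real exponentials
represents `f` as a superposition of exponentials, where D^α acts as multiplication by a product of
linear forms (`exists_youngFactor_mul_norm_multiDeriv_le`). -/

/-! ### Weight functions of one variable. -/

namespace IsWeightFunction

variable {ω : ℝ → ℝ}

/-- Substitute for subadditivity: b + c ≤ 2 max(b, c), so monotonicity and doubling suffice. -/
lemma le_of_le_add (h : IsWeightFunction ω) :
    ∃ K : ℝ, 1 ≤ K ∧ ∀ a b c : ℝ, 0 ≤ a → 0 ≤ b → 0 ≤ c → a ≤ b + c →
      ω a ≤ K * (1 + ω b + ω c) := by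
  obtain ⟨K, hK, hd⟩ := h.doubling
  refine ⟨K, hK, fun a b c ha hb hc habc => ?_⟩
  have hb' := h.nonneg b hb
  have hc' := h.nonneg c hc
  rcases le_total b c with hbc | hbc
  · have h1 : ω a ≤ ω (2 * c) := h.monotoneOn ha (by simp; linarith) (by linarith)
    have h2 := hd c hc
    nlinarith
  · have h1 : ω a ≤ ω (2 * b) := h.monotoneOn ha (by simp; linarith) (by linarith)
    have h2 := hd b hb
    nlinarith

lemma comp_mul_le (h : IsWeightFunction ω) (M : ℝ) (hM : 0 ≤ M) :
    ∃ L : ℝ, 1 ≤ L ∧ ∀ x : ℝ, 0 ≤ x → ω (M * x) ≤ L * (1 + ω x) := by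
  obtain ⟨K, hK, hd⟩ := h.doubling
  obtain ⟨n, hn⟩ := pow_unbounded_of_one_lt M (one_lt_two)
  have key : ∀ n : ℕ, ∃ L : ℝ, 1 ≤ L ∧ ∀ x : ℝ, 0 ≤ x → ω (2 ^ n * x) ≤ L * (1 + ω x) := by
    intro n
    induction n with
    | zero => exact ⟨1, le_rfl, fun x hx => by simp⟩
    | succ n ih =>
      obtain ⟨L, hL, hLx⟩ := ih
      refine ⟨K * (1 + L), by nlinarith, fun x hx => ?_⟩
      have h1 := hd (2 ^ n * x) (by positivity)
      have h2 := hLx x hx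
      have h3 := h.nonneg x hx
      have : K * (1 + ω (2 ^ n * x)) ≤ K * ((1 + L) * (1 + ω x)) := by
        apply mul_le_mul_of_nonneg_left _ (by linarith)
        nlinarith
      rw [pow_succ', mul_assoc, mul_assoc]
      exact h1.trans this
  obtain ⟨L, hL, hLx⟩ := key n
  refine ⟨L, hL, fun x hx => le_trans ?_ (hLx x hx)⟩
  exact h.monotoneOn (by simp; positivity) (by simp; positivity) (by gcongr)

/-- Condition (γ) exponentiated. This is what lets an exponential weight pay for any polynomial
loss. -/
lemma one_add_sq_le_exp (h : IsWeightFunction ω) :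
    ∃ C c : ℝ, 0 < C ∧ 0 < c ∧ ∀ x : ℝ, 1 + x ^ 2 ≤ C * Real.exp (c * ω |x|) := by
  obtain ⟨a, b, hb, hab⟩ := h.log_le
  refine ⟨Real.exp (-(2 / b) * a), 2 / b, by positivity, by positivity, fun x => ?_⟩
  have h1 := hab |x| (abs_nonneg x)
  have h2 : 2 * Real.log (1 + |x|) ≤ -(2 / b) * a + (2 / b) * ω |x| := by
    have : 2 * Real.log (1 + |x|) = (2 / b) * (b * Real.log (1 + |x|)) := by field_simp
    rw [this]
    have : 0 < 2 / b := by positivity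
    nlinarith
  rw [← Real.exp_add]
  refine le_trans ?_ (Real.exp_le_exp.2 h2)
  have h3 : (0 : ℝ) < 1 + |x| := by positivity
  rw [two_mul, Real.exp_add, Real.exp_log h3]
  nlinarith [abs_nonneg x, sq_abs x]

lemma youngConj_ne_bot (ω : ℝ → ℝ) (s : ℝ) : youngConj ω s ≠ ⊥ := by
  intro h
  have : ((0 * s - ω (Real.exp 0) : ℝ) : EReal) ≤ youngConj ω s :=
    le_iSup₂_of_le (f := fun t (_ : t ∈ Set.Ici (0 : ℝ)) =>
      ((t * s - ω (Real.exp t) : ℝ) : EReal)) 0 (by simp) le_rfl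
  rw [h, le_bot_iff] at this
  exact EReal.coe_ne_bot _ this

lemma le_youngConj (ω : ℝ → ℝ) {s t : ℝ} (ht : 0 ≤ t) :
    ((t * s - ω (Real.exp t) : ℝ) : EReal) ≤ youngConj ω s :=
  le_iSup₂_of_le (f := fun t (_ : t ∈ Set.Ici (0 : ℝ)) =>
      ((t * s - ω (Real.exp t) : ℝ) : EReal)) t ht le_rfl

end IsWeightFunction

/-! ### The exponential of extended reals. -/

lemma expE_nonneg (a : EReal) : 0 ≤ expE a := ENNReal.toReal_nonneg

lemma expE_coe (a : ℝ) : expE a = Real.exp a := by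
  simp [expE, EReal.exp_coe, ENNReal.toReal_ofReal (Real.exp_pos a).le]

lemma expE_add (a b : EReal) : expE (a + b) = expE a * expE b := by
  simp [expE, EReal.exp_add]

lemma expE_neg_mul_le {r : ℝ} (hr : 0 < r) {y : ℝ} {a : EReal} (h : (y : EReal) ≤ a) :
    expE (-((r : EReal) * a)) ≤ Real.exp (-(r * y)) := by
  induction a with
  | bot => simp at h
  | top =>
    rw [EReal.coe_mul_top_of_pos hr]
    simp [expE, (Real.exp_pos _).le]
  | coe a =>
    rw [← EReal.coe_mul, ← EReal.coe_neg, expE_coe]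
    have := EReal.coe_le_coe_iff.1 h
    gcongr

lemma le_expE_neg_mul {r : ℝ} (hr : 0 < r) {y : ℝ} {a : EReal} (ha : a ≠ ⊥)
    (h : a ≤ (y : EReal)) :
    Real.exp (-(r * y)) ≤ expE (-((r : EReal) * a)) := by
  induction a with
  | bot => simp at ha
  | top => simp at h
  | coe a =>
    rw [← EReal.coe_mul, ← EReal.coe_neg, expE_coe]
    have := EReal.coe_le_coe_iff.1 h
    gcongr

/-- The value `⊥` has to be excluded because `⊤ + ⊥ = ⊥` in `EReal`; `⊤` is harmless and makes both
sides 0. -/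
lemma expE_neg_mul_add {r : ℝ} (hr : 0 < r) {a b : EReal} (ha : a ≠ ⊥) (hb : b ≠ ⊥) :
    expE (-((r : EReal) * (a + b))) = expE (-((r : EReal) * a)) * expE (-((r : EReal) * b)) := by
  rw [← expE_add]
  congr 1
  induction a with
  | bot => simp at ha
  | top =>
    induction b with
    | bot => simp at hb
    | top => simp [EReal.coe_mul_top_of_pos hr]
    | coe b =>
      rw [EReal.top_add_coe, EReal.coe_mul_top_of_pos hr, ← EReal.coe_mul]; rfl
  | coe a =>
    induction b with
    | bot => simp at hb
    | top =>
      rw [EReal.coe_add_top, EReal.coe_mul_top_of_pos hr, ← EReal.coe_mul]; rfl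
    | coe b => norm_cast; ring

lemma expE_neg_mul_sum {ι : Type*} (s : Finset ι) {r : ℝ} (hr : 0 < r) (a : ι → EReal)
    (ha : ∀ i, a i ≠ ⊥) :
    (∑ i ∈ s, a i) ≠ ⊥ ∧
      expE (-((r : EReal) * ∑ i ∈ s, a i)) = ∏ i ∈ s, expE (-((r : EReal) * a i)) := by
  classical
  induction s using Finset.induction_on with
  | empty => simp [expE]
  | insert i s hi ih =>
    rw [Finset.sum_insert hi, Finset.prod_insert hi, expE_neg_mul_add hr (ha i) ih.1, ih.2]
    refine ⟨?_, rfl⟩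
    simp [EReal.add_eq_bot_iff, ha i, ih.1]

/-! ### Powers against weights through the Young conjugate. -/

namespace IsWeightFunction

variable {ω : ℝ → ℝ}

lemma expE_youngConj_mul_pow_le (h : IsWeightFunction ω) {r : ℝ} (hr : 0 < r) (n : ℕ) {u : ℝ}
    (hu : 0 ≤ u) :
    expE (-((r : EReal) * youngConj ω (n / r))) * u ^ n ≤ Real.exp (r * ω 1 + r * ω u) := by
  -- The supremum runs over t ≥ 0 only, so it is tested at t = log max(1, u).
  set v := max 1 u with hv
  have hv1 : 1 ≤ v := le_max_left _ _
  have hv0 : 0 < v := by linarith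
  have h1 := le_youngConj ω (s := n / r) (Real.log_nonneg hv1)
  rw [Real.exp_log hv0] at h1
  calc expE (-((r : EReal) * youngConj ω (n / r))) * u ^ n
      ≤ Real.exp (-(r * (Real.log v * (n / r) - ω v))) * v ^ n := by
        gcongr
        · exact expE_neg_mul_le hr h1
        · exact le_max_right _ _
    _ = Real.exp (r * ω v) := by
        have : v ^ n = Real.exp (n * Real.log v) := by
          rw [Real.exp_nat_mul, Real.exp_log hv0]
        rw [this, ← Real.exp_add]
        congr 1
        field_simp
        ring
    _ ≤ _ := by
        apply Real.exp_le_exp.2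
        have h1 := h.nonneg 1 zero_le_one
        have h2 := h.nonneg u hu
        rcases le_total 1 u with h3 | h3
        · rw [hv, max_eq_right h3]; nlinarith
        · rw [hv, max_eq_left h3]; nlinarith

/-- The right derivative of the convex function ω(e^t) is a supporting slope; monotonicity makes it
nonnegative. -/
lemma exists_subgradient (h : IsWeightFunction ω) (t₀ : ℝ) :
    ∃ s : ℝ, 0 ≤ s ∧ ∀ t, ω (Real.exp t₀) + s * (t - t₀) ≤ ω (Real.exp t) := by
  have hc := h.convex_comp_exp
  set φ : ℝ → ℝ := fun t => ω (Real.exp t) with hφ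
  have hi : t₀ ∈ interior (Set.univ : Set ℝ) := by simp
  have hmono : Monotone φ := fun a b hab =>
    h.monotoneOn (Real.exp_pos a).le (Real.exp_pos b).le (Real.exp_le_exp.2 hab)
  have key : ∀ t, φ t₀ + derivWithin φ (Set.Ioi t₀) t₀ * (t - t₀) ≤ φ t := by
    intro t
    rcases lt_trichotomy t t₀ with ht | ht | ht
    · have h1 := hc.slope_le_leftDeriv_of_mem_interior (Set.mem_univ t) hi ht
      have h2 := h1.trans (hc.leftDeriv_le_rightDeriv_of_mem_interior hi)
      rw [slope_def_field, div_le_iff₀ (by linarith)] at h2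
      linarith
    · simp [ht]
    · have h1 := hc.rightDeriv_le_slope_of_mem_interior hi (Set.mem_univ t) ht
      rw [slope_def_field, le_div_iff₀ (by linarith)] at h1
      linarith
  refine ⟨_, ?_, key⟩
  have h1 := key (t₀ - 1)
  have h2 := hmono (by linarith : t₀ - 1 ≤ t₀)
  linarith

/-- A discrete form of biconjugation: n is the integer part of a supporting slope at log u. The
factor e^{-n} is bought by evaluating the supporting line at t + 1, which costs only the constant L
of ω(ex) ≤ L(1 + ω(x)). It later makes sums over multi-indices converge. -/
lemma exp_le_expE_youngConj_mul_pow (h : IsWeightFunction ω) {r : ℝ} (hr : 0 < r) :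
    ∃ μ₀ C : ℝ, 0 < μ₀ ∧ 0 < C ∧ ∀ μ, μ₀ ≤ μ → ∀ u : ℝ, 0 ≤ u → ∃ n : ℕ,
      Real.exp (r * ω u) ≤
        C * (Real.exp (-n) * (u ^ n * expE (-((μ : EReal) * youngConj ω (n / μ))))) := by
  obtain ⟨C, c, hC, hc, hCc⟩ := h.one_add_sq_le_exp
  obtain ⟨L, hL, hLx⟩ := h.comp_mul_le (Real.exp 1) (Real.exp_pos 1).le
  -- The extra c pays for one factor u, lost when the slope is rounded down.
  set lam := r + c with hlam
  have hlam0 : 0 < lam := by positivity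
  refine ⟨lam * L, max (Real.exp (r * ω 1)) (C * Real.exp (lam * L)), by positivity,
    lt_max_of_lt_left (Real.exp_pos _), fun μ hμ u hu => ?_⟩
  have hμ0 : 0 < μ := lt_of_lt_of_le (by positivity) hμ
  rcases le_total u 1 with hu1 | hu1
  · refine ⟨0, ?_⟩
    have h1 : (1 : ℝ) ≤ expE (-((μ : EReal) * youngConj ω ((0 : ℕ) / μ))) := by
      refine le_trans ?_ (le_expE_neg_mul hμ0 (youngConj_ne_bot _ _) (y := 0) ?_)
      · simp
      · refine iSup₂_le fun t _ => ?_
        have := h.nonneg _ (Real.exp_pos t).le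
        exact_mod_cast (by simpa using this : t * ((0 : ℕ) / μ) - ω (Real.exp t) ≤ 0)
    have h2 : Real.exp (r * ω u) ≤ Real.exp (r * ω 1) := by
      apply Real.exp_le_exp.2
      exact mul_le_mul_of_nonneg_left (h.monotoneOn hu (by simp) hu1) hr.le
    calc _ ≤ Real.exp (r * ω 1) * 1 := by simpa using h2
      _ ≤ _ := by
        simp only [Nat.cast_zero, neg_zero, Real.exp_zero, pow_zero, one_mul]
        exact mul_le_mul (le_max_left _ _) (by simpa using h1) zero_le_one (by positivity)
  · have hu0 : 0 < u := by linarith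
    set t₀ := Real.log u with ht₀
    have ht₀0 : 0 ≤ t₀ := Real.log_nonneg hu1
    have het : Real.exp t₀ = u := Real.exp_log hu0
    obtain ⟨s, hs, hsub⟩ := h.exists_subgradient t₀
    rw [het] at hsub
    set n := ⌊lam * s⌋₊ with hn
    have hn1 : (n : ℝ) ≤ lam * s := Nat.floor_le (by positivity)
    have hn2 : lam * s ≤ n + 1 := (Nat.lt_floor_add_one _).le
    refine ⟨n, ?_⟩
    -- The term -n comes from the shift t + 1; n + 1 in front of t₀ comes from lam * s ≤ n + 1.
    set Y := lam * L - lam * ω u - n + (n + 1) * t₀ with hY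
    have hconj : youngConj ω (n / μ) ≤ ((Y / μ : ℝ) : EReal) := by
      refine iSup₂_le fun t ht => ?_
      have ht : 0 ≤ t := ht
      apply EReal.coe_le_coe_iff.2
      rw [le_div_iff₀ hμ0]
      have h1 : (t * (n / μ) - ω (Real.exp t)) * μ = t * n - μ * ω (Real.exp t) := by field_simp
      rw [h1]
      have h2 := hsub (1 + t)
      rw [Real.exp_add] at h2
      have h3 := hLx (Real.exp t) (Real.exp_pos t).le
      have h4 := h.nonneg _ (Real.exp_pos t).le
      have h5 : lam * L * ω (Real.exp t) ≤ μ * ω (Real.exp t) := by gcongr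
      have h6 : lam * (ω u + s * (1 + t - t₀)) ≤ lam * (L * (1 + ω (Real.exp t))) := by
        apply mul_le_mul_of_nonneg_left (h2.trans h3) hlam0.le
      have h7 : (n : ℝ) * (1 + t) ≤ lam * s * (1 + t) := by gcongr
      have h8 : lam * s * t₀ ≤ (n + 1) * t₀ := by gcongr
      rw [hY]
      linarith
    have h1 := le_expE_neg_mul hμ0 (youngConj_ne_bot _ _) hconj
    have h2 : -(μ * (Y / μ)) = -Y := by field_simp
    rw [h2] at h1
    have hun : u ^ n = Real.exp (n * t₀) := by rw [Real.exp_nat_mul, het]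
    have h3 : u ≤ C * Real.exp (c * ω u) := by
      have := hCc u
      rw [abs_of_pos hu0] at this
      nlinarith
    calc Real.exp (r * ω u) = Real.exp (lam * ω u) * Real.exp (-(c * ω u)) := by
          rw [← Real.exp_add]; congr 1; rw [hlam]; ring
      _ = (Real.exp (lam * L) * (Real.exp (-n) * (u ^ n * Real.exp (-Y)))) * 
            (u * Real.exp (-(c * ω u))) := by
          nth_rewrite 4 [← het]
          rw [hun]
          simp only [← Real.exp_add]
          congr 1
          rw [hY]
          ring
      _ ≤ (Real.exp (lam * L) * (Real.exp (-n) * (u ^ n *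
            expE (-((μ : EReal) * youngConj ω (n / μ)))))) * C := by
          have h0 := expE_nonneg (-((μ : EReal) * youngConj ω (n / μ)))
          gcongr
          rw [Real.exp_neg, ← div_eq_mul_inv, div_le_iff₀ (Real.exp_pos _)]
          exact h3
      _ = (C * Real.exp (lam * L)) * (Real.exp (-n) * (u ^ n *
            expE (-((μ : EReal) * youngConj ω (n / μ))))) := by ring
      _ ≤ _ := by
          have h0 := expE_nonneg (-((μ : EReal) * youngConj ω (n / μ)))
          gcongr
          exact le_max_right _ _

/-- For large r the slope n / r is at most the b of condition (γ), so the conjugate is finite there.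
-/
lemma exists_expE_youngConj_pos (h : IsWeightFunction ω) (n : ℕ) :
    ∃ R : ℝ, 0 < R ∧ ∀ r, R ≤ r → 0 < expE (-((r : EReal) * youngConj ω (n / r))) := by
  obtain ⟨a, b, hb, hab⟩ := h.log_le
  refine ⟨(n + 1) / b, by positivity, fun r hr => ?_⟩
  have hr0 : 0 < r := lt_of_lt_of_le (by positivity) hr
  refine lt_of_lt_of_le (Real.exp_pos _) (le_expE_neg_mul hr0 (youngConj_ne_bot _ _) (y := -a) ?_)
  refine iSup₂_le fun t ht => ?_
  have ht : 0 ≤ t := ht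
  apply EReal.coe_le_coe_iff.2
  have h1 := hab (Real.exp t) (Real.exp_pos t).le
  have h2 : t ≤ Real.log (1 + Real.exp t) := by
    rw [Real.le_log_iff_exp_le (by positivity)]; linarith
  have h3 : (n : ℝ) / r ≤ b := by
    rw [div_le_iff₀ hr0]
    rw [div_le_iff₀ hb] at hr
    linarith
  nlinarith

end IsWeightFunction

/-! ### Weights on ℝ^N and the polynomial weight. -/

section SumWeight

variable {N : ℕ} {ω : Fin N → ℝ → ℝ}

lemma sumWeight_nonneg (hω : ∀ j, IsWeightFunction (ω j)) (x : EuclideanSpace ℝ (Fin N)) :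
    0 ≤ sumWeight ω x :=
  Finset.sum_nonneg fun j _ => (hω j).nonneg _ (abs_nonneg _)

lemma sumWeight_le_of_abs_le (hω : ∀ j, IsWeightFunction (ω j)) {x y : EuclideanSpace ℝ (Fin N)}
    (hxy : ∀ j, |x j| ≤ |y j|) : sumWeight ω x ≤ sumWeight ω y :=
  Finset.sum_le_sum fun j _ => (hω j).monotoneOn (Set.mem_Ici.2 (abs_nonneg _)) (Set.mem_Ici.2 (abs_nonneg _)) (hxy j)

lemma continuous_sumWeight (hω : ∀ j, IsWeightFunction (ω j)) : Continuous (sumWeight ω) := by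
  refine continuous_finsetSum _ fun j _ => ?_
  exact (hω j).continuousOn.comp_continuous (by fun_prop) fun x => Set.mem_Ici.2 (abs_nonneg _)

lemma sumWeight_le_of_abs_le_add (hω : ∀ j, IsWeightFunction (ω j)) :
    ∃ K : ℝ, 1 ≤ K ∧ ∀ x y z : EuclideanSpace ℝ (Fin N), (∀ j, |x j| ≤ |y j| + |z j|) →
      sumWeight ω x ≤ K * (1 + sumWeight ω y + sumWeight ω z) := by
  choose K hK hKx using fun j => (hω j).le_of_le_add
  -- The summand 1 keeps the constant at least 1 when N = 0.
  refine ⟨1 + ∑ j, K j, ?_, fun x y z hxyz => ?_⟩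
  · have : 0 ≤ ∑ j, K j := Finset.sum_nonneg fun j _ => by linarith [hK j]
    linarith
  · have hy := sumWeight_nonneg hω y
    have hz := sumWeight_nonneg hω z
    calc sumWeight ω x ≤ ∑ j, K j * (1 + sumWeight ω y + sumWeight ω z) := by
          refine Finset.sum_le_sum fun j _ => ?_
          refine (hKx j _ _ _ (abs_nonneg _) (abs_nonneg _) (abs_nonneg _) (hxyz j)).trans ?_
          have h1 : ∀ w : EuclideanSpace ℝ (Fin N), ω j |w j| ≤ sumWeight ω w := fun w =>
            Finset.single_le_sum (f := fun j => ω j |w j|)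
              (fun i _ => (hω i).nonneg _ (abs_nonneg _)) (Finset.mem_univ j)
          have := h1 y
          have := h1 z
          have := hK j
          gcongr
      _ = (∑ j, K j) * (1 + sumWeight ω y + sumWeight ω z) := by rw [Finset.sum_mul]
      _ ≤ _ := by gcongr; linarith

lemma sumWeight_smul_le (hω : ∀ j, IsWeightFunction (ω j)) (M : ℝ) :
    ∃ K : ℝ, 1 ≤ K ∧ ∀ x : EuclideanSpace ℝ (Fin N),
      sumWeight ω (M • x) ≤ K * (1 + sumWeight ω x) := by
  choose K hK hKx using fun j => (hω j).comp_mul_le |M| (abs_nonneg M)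
  refine ⟨1 + ∑ j, K j, ?_, fun x => ?_⟩
  · have : 0 ≤ ∑ j, K j := Finset.sum_nonneg fun j _ => by linarith [hK j]
    linarith
  · have hx := sumWeight_nonneg hω x
    calc sumWeight ω (M • x) ≤ ∑ j, K j * (1 + sumWeight ω x) := by
          refine Finset.sum_le_sum fun j _ => ?_
          rw [PiLp.smul_apply, smul_eq_mul, abs_mul]
          refine (hKx j _ (abs_nonneg _)).trans ?_
          have h1 : ω j |x j| ≤ sumWeight ω x :=
            Finset.single_le_sum (f := fun j => ω j |x j|)
              (fun i _ => (hω i).nonneg _ (abs_nonneg _)) (Finset.mem_univ j)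
          have := hK j
          gcongr
      _ = (∑ j, K j) * (1 + sumWeight ω x) := by rw [Finset.sum_mul]
      _ ≤ _ := by gcongr; linarith

/-- The polynomial weight `∏ (1 + x_j²)`. -/
noncomputable def polyWeight (x : EuclideanSpace ℝ (Fin N)) : ℝ := ∏ j, (1 + x j ^ 2)

lemma one_le_polyWeight (x : EuclideanSpace ℝ (Fin N)) : 1 ≤ polyWeight x := by
  simpa [polyWeight] using Finset.prod_le_prod (s := Finset.univ) (f := fun _ : Fin N => (1 : ℝ))
    (fun _ _ => zero_le_one) (fun j _ => le_add_of_nonneg_right (sq_nonneg (x j)))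

lemma polyWeight_pos (x : EuclideanSpace ℝ (Fin N)) : 0 < polyWeight x :=
  zero_lt_one.trans_le (one_le_polyWeight x)

lemma continuous_polyWeight : Continuous (polyWeight (N := N)) := by
  unfold polyWeight; fun_prop

lemma polyWeight_le_exp_sumWeight (hω : ∀ j, IsWeightFunction (ω j)) :
    ∃ C c : ℝ, 0 < C ∧ 0 < c ∧ ∀ x : EuclideanSpace ℝ (Fin N),
      polyWeight x ≤ C * Real.exp (c * sumWeight ω x) := by
  choose C c hC hc h using fun j => (hω j).one_add_sq_le_exp
  refine ⟨∏ j, C j, 1 + ∑ j, c j, Finset.prod_pos fun j _ => hC j, ?_, fun x => ?_⟩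
  · have : 0 ≤ ∑ j, c j := Finset.sum_nonneg fun j _ => (hc j).le
    linarith
  · calc polyWeight x ≤ ∏ j, (C j * Real.exp (c j * ω j |x j|)) :=
          Finset.prod_le_prod (fun j _ => by positivity) fun j _ => h j _
      _ = (∏ j, C j) * Real.exp (∑ j, c j * ω j |x j|) := by
          rw [Finset.prod_mul_distrib, Real.exp_sum]
      _ ≤ _ := by
          have : 0 ≤ ∏ j, C j := (Finset.prod_pos fun j _ => hC j).le
          gcongr
          unfold sumWeight
          rw [Finset.mul_sum]
          refine Finset.sum_le_sum fun j _ => ?_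
          have h1 := (hω j).nonneg _ (abs_nonneg (x j))
          have h2 : c j ≤ ∑ j, c j := Finset.single_le_sum (fun i _ => (hc i).le) (Finset.mem_univ j)
          gcongr
          linarith

/-- The factor `exp (-r Ω*(β / r))`. -/
noncomputable def youngFactor (ω : Fin N → ℝ → ℝ) (r : ℝ) (β : Fin N → ℕ) : ℝ :=
  expE (-((r : EReal) * sumYoungConj ω (fun j => (β j : ℝ) / r)))

lemma youngFactor_nonneg (ω : Fin N → ℝ → ℝ) (r : ℝ) (β : Fin N → ℕ) : 0 ≤ youngFactor ω r β :=
  expE_nonneg _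

lemma youngFactor_eq_prod {r : ℝ} (hr : 0 < r) (β : Fin N → ℕ) :
    youngFactor ω r β = ∏ j, expE (-((r : EReal) * youngConj (ω j) (β j / r))) :=
  (expE_neg_mul_sum Finset.univ hr _ fun _ => IsWeightFunction.youngConj_ne_bot _ _).2

lemma expE_sub_eq_youngFactor_mul (ω σ : Fin N → ℝ → ℝ) (r s : ℝ) (α β : Fin N → ℕ) :
    expE (-((r : EReal) * sumYoungConj σ (fun j => (α j : ℝ) / r)) -
      (s : EReal) * sumYoungConj ω (fun j => (β j : ℝ) / s)) =
      youngFactor σ r α * youngFactor ω s β := by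
  rw [sub_eq_add_neg, expE_add]; rfl

lemma youngFactor_mul_prod_le (hω : ∀ j, IsWeightFunction (ω j)) {r : ℝ} (hr : 0 < r) :
    ∃ C : ℝ, 0 < C ∧ ∀ (β : Fin N → ℕ) (x : EuclideanSpace ℝ (Fin N)),
      youngFactor ω r β * ∏ j, |x j| ^ β j ≤ C * Real.exp (r * sumWeight ω x) := by
  refine ⟨Real.exp (∑ j, r * ω j 1), Real.exp_pos _, fun β x => ?_⟩
  rw [youngFactor_eq_prod hr, ← Finset.prod_mul_distrib, sumWeight, Finset.mul_sum, ← Real.exp_add,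
    ← Finset.sum_add_distrib, Real.exp_sum]
  exact Finset.prod_le_prod (fun j _ => mul_nonneg (expE_nonneg _) (by positivity))
    fun j _ => (hω j).expE_youngConj_mul_pow_le hr _ (abs_nonneg _)

/-- A single μ serves all coordinates because the one-variable estimate holds for every μ beyond its
threshold. -/
lemma exp_sumWeight_le_youngFactor (hω : ∀ j, IsWeightFunction (ω j)) {r : ℝ} (hr : 0 < r) :
    ∃ μ C : ℝ, 0 < μ ∧ 0 < C ∧ ∀ x : EuclideanSpace ℝ (Fin N), ∃ β : Fin N → ℕ,
      Real.exp (r * sumWeight ω x) ≤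
        C * ((∏ j, Real.exp (-(β j : ℝ))) * ((∏ j, |x j| ^ β j) * youngFactor ω μ β)) := by
  choose μ C hμ hC h using fun j => (hω j).exp_le_expE_youngConj_mul_pow hr
  have hle : ∀ j, μ j ≤ 1 + ∑ j, μ j := fun j => by
    have := Finset.single_le_sum (f := μ) (fun i _ => (hμ i).le) (Finset.mem_univ j)
    linarith
  have hpos : 0 < 1 + ∑ j, μ j := by
    have : 0 ≤ ∑ j, μ j := Finset.sum_nonneg fun j _ => (hμ j).le
    linarith
  refine ⟨1 + ∑ j, μ j, ∏ j, C j, hpos, Finset.prod_pos fun j _ => hC j, fun x => ?_⟩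
  choose β hβ using fun j => h j _ (hle j) |x j| (abs_nonneg _)
  refine ⟨β, ?_⟩
  rw [youngFactor_eq_prod hpos, ← Finset.prod_mul_distrib, ← Finset.prod_mul_distrib,
    ← Finset.prod_mul_distrib, sumWeight, Finset.mul_sum, Real.exp_sum]
  exact Finset.prod_le_prod (fun j _ => (Real.exp_pos _).le) fun j _ => hβ j

/-- Guarantees that, for a fixed multi-index, the factor can be divided out. -/
lemma exists_youngFactor_pos (hω : ∀ j, IsWeightFunction (ω j)) (β : Fin N → ℕ) :
    ∃ r : ℝ, 0 < r ∧ 0 < youngFactor ω r β := by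
  choose R hR h using fun j => (hω j).exists_expE_youngConj_pos (β j)
  have hpos : 0 < 1 + ∑ j, R j := by
    have : 0 ≤ ∑ j, R j := Finset.sum_nonneg fun j _ => (hR j).le
    linarith
  refine ⟨1 + ∑ j, R j, hpos, ?_⟩
  rw [youngFactor_eq_prod hpos]
  refine Finset.prod_pos fun j _ => h j _ ?_
  have := Finset.single_le_sum (f := R) (fun i _ => (hR i).le) (Finset.mem_univ j)
  linarith

end SumWeight

/-! ### L^p bounds through the polynomial weight. -/

section Integrability

variable {N : ℕ}

lemma integrable_inv_polyWeight :
    Integrable (fun x : EuclideanSpace ℝ (Fin N) => (polyWeight x)⁻¹) := by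
  have h : Integrable (fun x : Fin N → ℝ => ∏ j, (1 + x j ^ 2)⁻¹) :=
    Integrable.fintype_prod (f := fun _ (t : ℝ) => (1 + t ^ 2)⁻¹)
      fun _ => integrable_inv_one_add_sq
  have h2 := (PiLp.volume_preserving_ofLp (Fin N)).integrable_comp_of_integrable h
  refine h2.congr (Eventually.of_forall fun x => ?_)
  simp [polyWeight, Finset.prod_inv_distrib]

lemma inv_polyWeight_le_one (x : EuclideanSpace ℝ (Fin N)) : (polyWeight x)⁻¹ ≤ 1 :=
  inv_le_one_of_one_le₀ (one_le_polyWeight x)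

lemma continuous_inv_polyWeight :
    Continuous (fun x : EuclideanSpace ℝ (Fin N) => (polyWeight x)⁻¹) :=
  continuous_polyWeight.inv₀ fun x => (polyWeight_pos x).ne'

lemma memLp_inv_polyWeight {p : ℝ≥0∞} (hp : 1 ≤ p) :
    MemLp (fun x : EuclideanSpace ℝ (Fin N) => (polyWeight x)⁻¹) p := by
  have hm := (continuous_inv_polyWeight (N := N)).aestronglyMeasurable (μ := volume)
  have h0 : ∀ x : EuclideanSpace ℝ (Fin N), 0 ≤ (polyWeight x)⁻¹ := fun x =>
    (inv_pos.2 (polyWeight_pos x)).le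
  rcases eq_or_ne p ∞ with rfl | hp'
  · refine memLp_top_of_bound hm 1 (Eventually.of_forall fun x => ?_)
    rw [Real.norm_of_nonneg (h0 x)]
    exact inv_polyWeight_le_one x
  · rw [← integrable_norm_rpow_iff hm (by positivity) hp']
    refine integrable_inv_polyWeight.mono' (continuous_inv_polyWeight.norm.rpow_const
      fun _ => Or.inr ENNReal.toReal_nonneg).aestronglyMeasurable (Eventually.of_forall fun x => ?_)
    have h1 : 1 ≤ p.toReal := by
      rw [← ENNReal.toReal_one]; exact ENNReal.toReal_mono hp' hp
    rw [Real.norm_of_nonneg (h0 x), Real.norm_of_nonneg (Real.rpow_nonneg (h0 x) _)]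
    exact (Real.rpow_le_rpow_of_exponent_ge (inv_pos.2 (polyWeight_pos x))
      (inv_polyWeight_le_one x) h1).trans_eq (Real.rpow_one _)

lemma exists_eLpNorm_le_of_norm_le_inv_polyWeight {p : ℝ≥0∞} (hp : 1 ≤ p) :
    ∃ A : ℝ, 0 < A ∧ ∀ (F : EuclideanSpace ℝ (Fin N) → ℂ) (C : ℝ), 0 ≤ C →
      (∀ x, ‖F x‖ ≤ C * (polyWeight x)⁻¹) → eLpNorm F p volume ≤ ENNReal.ofReal (C * A) := by
  have hW := memLp_inv_polyWeight (N := N) hp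
  refine ⟨(eLpNorm (fun x : EuclideanSpace ℝ (Fin N) => (polyWeight x)⁻¹) p volume).toReal + 1,
    by positivity, fun F C hC h => ?_⟩
  have h1 : eLpNorm F p volume ≤ ENNReal.ofReal C *
      eLpNorm (fun x : EuclideanSpace ℝ (Fin N) => (polyWeight x)⁻¹) p volume := by
    refine eLpNorm_le_mul_eLpNorm_of_ae_le_mul (Eventually.of_forall fun x => ?_) p
    rw [Real.norm_of_nonneg (inv_pos.2 (polyWeight_pos x)).le]
    exact h x
  refine h1.trans ?_
  rw [ENNReal.ofReal_mul hC]
  gcongr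
  rw [← ENNReal.ofReal_toReal hW.eLpNorm_ne_top, ENNReal.toReal_ofReal (by positivity)]
  exact ENNReal.ofReal_le_ofReal (by linarith)

/-- Hölder's inequality, the inverse polynomial weight lying in the conjugate L^q. -/
lemma exists_eLpNorm_one_inv_polyWeight_mul_le {p : ℝ≥0∞} (hp : 1 ≤ p) :
    ∃ A : ℝ, 0 < A ∧ ∀ F : EuclideanSpace ℝ (Fin N) → ℂ, AEStronglyMeasurable F volume →
      eLpNorm (fun x => (((polyWeight x)⁻¹ : ℝ) : ℂ) * F x) 1 volume ≤
        ENNReal.ofReal A * eLpNorm F p volume := by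
  have hconj := ENNReal.HolderConjugate.conjExponent hp
  have hq : 1 ≤ p.conjExponent := hconj.symm.one_le
  have hW := memLp_inv_polyWeight (N := N) hq
  refine ⟨(eLpNorm (fun x : EuclideanSpace ℝ (Fin N) => (polyWeight x)⁻¹) p.conjExponent
    volume).toReal + 1, by positivity, fun F hF => ?_⟩
  have h3 : ENNReal.HolderTriple p.conjExponent p 1 := hconj.symm
  have h1 := eLpNorm_smul_le_mul_eLpNorm (p := p.conjExponent) (q := p) (r := 1) hF hW.1
  have h2 : ((fun x : EuclideanSpace ℝ (Fin N) => (polyWeight x)⁻¹) • F) =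
      fun x => (((polyWeight x)⁻¹ : ℝ) : ℂ) * F x := by
    ext x; simp [Complex.real_smul]
  rw [h2] at h1
  refine h1.trans ?_
  gcongr
  rw [← ENNReal.ofReal_toReal hW.eLpNorm_ne_top, ENNReal.toReal_ofReal (by positivity)]
  exact ENNReal.ofReal_le_ofReal (by linarith)

end Integrability

/-! ### Rapid decay: passage from L^p, monomials, derivatives. -/

section RapidDecay

variable {N : ℕ} {ω : Fin N → ℝ → ℝ}

/-- `g = O(exp (-r Ω))` for every `r > 0`. -/
def RapidDecay (ω : Fin N → ℝ → ℝ) (g : EuclideanSpace ℝ (Fin N) → ℂ) : Prop :=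
  ∀ r : ℝ, 0 < r → ∃ C : ℝ, 0 < C ∧ ∀ x, ‖g x‖ ≤ C * Real.exp (-(r * sumWeight ω x))

lemma exists_eLpNorm_exp_sumWeight_mul_le (hω : ∀ j, IsWeightFunction (ω j)) {p : ℝ≥0∞}
    (hp : 1 ≤ p) :
    ∃ A c : ℝ, 0 < A ∧ 0 < c ∧ ∀ (F : EuclideanSpace ℝ (Fin N) → ℂ) (C : ℝ), 0 ≤ C →
      (∀ x, ‖F x‖ ≤ C * Real.exp (-(c * sumWeight ω x))) →
      eLpNorm F p volume ≤ ENNReal.ofReal (C * A) := by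
  obtain ⟨A, hA, h⟩ := exists_eLpNorm_le_of_norm_le_inv_polyWeight (N := N) hp
  obtain ⟨B, c, hB, hc, hBc⟩ := polyWeight_le_exp_sumWeight hω
  refine ⟨B * A, c, by positivity, hc, fun F C hC hF => ?_⟩
  rw [← mul_assoc]
  refine h F (C * B) (by positivity) fun x => (hF x).trans ?_
  rw [mul_assoc]
  gcongr
  rw [Real.exp_neg, ← div_eq_mul_inv, inv_eq_one_div,
    div_le_div_iff₀ (Real.exp_pos _) (polyWeight_pos x), one_mul]
  exact hBc x

lemma RapidDecay.eLpNorm_exp_mul_lt_top (hω : ∀ j, IsWeightFunction (ω j)) {p : ℝ≥0∞}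
    (hp : 1 ≤ p) {g : EuclideanSpace ℝ (Fin N) → ℂ} (hg : RapidDecay ω g) {r : ℝ} (hr : 0 < r) :
    eLpNorm (fun x => (Real.exp (r * sumWeight ω x) : ℂ) * g x) p volume < ∞ := by
  obtain ⟨A, c, hA, hc, h⟩ := exists_eLpNorm_exp_sumWeight_mul_le hω hp
  obtain ⟨C, hC, hgC⟩ := hg (r + c) (by positivity)
  refine (h _ C hC.le fun x => ?_).trans_lt ENNReal.ofReal_lt_top
  rw [norm_mul, Complex.norm_real, Real.norm_of_nonneg (Real.exp_pos _).le]
  calc _ ≤ Real.exp (r * sumWeight ω x) * (C * Real.exp (-((r + c) * sumWeight ω x))) := by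
        gcongr; exact hgC x
    _ = C * Real.exp (-(c * sumWeight ω x)) := by
        rw [mul_left_comm, ← Real.exp_add]; congr 2; ring

lemma RapidDecay.monomialFun_mul (hω : ∀ j, IsWeightFunction (ω j))
    {g : EuclideanSpace ℝ (Fin N) → ℂ} (hg : RapidDecay ω g) (α : Fin N → ℕ) :
    RapidDecay ω (fun x => (monomialFun α x : ℂ) * g x) := by
  intro r hr
  obtain ⟨s, hs, hpos⟩ := exists_youngFactor_pos hω α
  obtain ⟨B, hB, hBx⟩ := youngFactor_mul_prod_le hω hs
  obtain ⟨C, hC, hgC⟩ := hg (s + r) (by positivity)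
  refine ⟨B / youngFactor ω s α * C, by positivity, fun x => ?_⟩
  have h1 : ‖(monomialFun α x : ℂ)‖ ≤ B / youngFactor ω s α * Real.exp (s * sumWeight ω x) := by
    rw [div_mul_eq_mul_div, le_div_iff₀ hpos, mul_comm]
    simpa [monomialFun, abs_mul, Finset.abs_prod, abs_pow] using hBx α x
  rw [norm_mul]
  calc _ ≤ (B / youngFactor ω s α * Real.exp (s * sumWeight ω x)) *
        (C * Real.exp (-((s + r) * sumWeight ω x))) := by
        gcongr
        exact hgC x
    _ = B / youngFactor ω s α * C * Real.exp (-(r * sumWeight ω x)) := by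
        rw [mul_mul_mul_comm, ← Real.exp_add]; congr 2; ring

lemma sumWeight_le_of_norm_sub_le_one (hω : ∀ j, IsWeightFunction (ω j)) :
    ∃ K A : ℝ, 1 ≤ K ∧ 0 ≤ A ∧ ∀ x y : EuclideanSpace ℝ (Fin N), ‖x - y‖ ≤ 1 →
      sumWeight ω x ≤ K * sumWeight ω y + A := by
  obtain ⟨K, hK, h⟩ := sumWeight_le_of_abs_le_add hω
  set z : EuclideanSpace ℝ (Fin N) := WithLp.toLp 2 fun _ => 1
  have hz := sumWeight_nonneg hω z
  refine ⟨K, K * (1 + sumWeight ω z), hK, by positivity, fun x y hxy => ?_⟩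
  refine (h x y z fun j => ?_).trans (by linarith)
  have h1 : |(x - y) j| ≤ 1 := (PiLp.norm_apply_le (x - y) j).trans hxy
  have h2 : |x j| ≤ |y j| + |(x - y) j| := by
    simpa using abs_add_le (y j) (x j - y j)
  simpa [z] using h2.trans (by linarith)

lemma SchwartzMap.exists_norm_le_and_norm_sub_le {E : Type*} [NormedAddCommGroup E]
    [NormedSpace ℝ E] (f : 𝓢(E, ℂ)) :
    ∃ M : ℝ, 1 ≤ M ∧ (∀ x, ‖f x‖ ≤ M) ∧ ∀ x y, ‖f x - f y‖ ≤ M * ‖x - y‖ := by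
  obtain ⟨C₀, hC₀, h₀⟩ := f.decay 0 0
  obtain ⟨C₁, hC₁, h₁⟩ := f.decay 0 1
  refine ⟨1 + C₀ + C₁, by linarith, fun x => ?_, fun x y => ?_⟩
  · have := h₀ x
    simp at this
    linarith
  · refine Convex.norm_image_sub_le_of_norm_fderiv_le (𝕜 := ℝ) (s := Set.univ)
      (fun z _ => f.differentiableAt) (fun z _ => ?_) convex_univ trivial trivial
    have := h₁ z
    rw [pow_zero, one_mul, norm_iteratedFDeriv_one] at this
    linarith

/-- With a = |f(x)| and Lipschitz constant M, |f| ≥ a/2 on the ball of radius a/(2M) around x. Its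
volume is proportional to a^N, so the weighted L^1 norm controls a^{N+1}. -/
lemma rapidDecay_of_integrable (hω : ∀ j, IsWeightFunction (ω j))
    (f : 𝓢(EuclideanSpace ℝ (Fin N), ℂ))
    (hf : ∀ r : ℝ, 0 < r → Integrable (fun x => Real.exp (r * sumWeight ω x) * ‖f x‖)) :
    RapidDecay ω f := by
  intro r hr
  obtain ⟨M, hM, hfM, hfL⟩ := f.exists_norm_le_and_norm_sub_le
  obtain ⟨K, A, hK, hA, hKA⟩ := sumWeight_le_of_norm_sub_le_one hω
  -- N + 1 compensates the final (N + 1)-st root, and K the comparison of Ω at x and at nearby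
  -- points.
  set s := K * (r * (N + 1)) with hs
  have hs0 : 0 < s := by positivity
  set I := ∫ x, Real.exp (s * sumWeight ω x) * ‖f x‖ with hI
  set v := volume.real (Metric.ball (0 : EuclideanSpace ℝ (Fin N)) 1) with hv
  have hv0 : 0 < v := by
    refine ENNReal.toReal_pos (Metric.measure_ball_pos _ _ zero_lt_one).ne' measure_ball_lt_top.ne
  have hI0 : 0 ≤ I := integral_nonneg fun x => by positivity
  set C := I * 2 * (2 * M) ^ N * Real.exp (r * (N + 1) * A) / v with hC
  refine ⟨max 1 C, by positivity, fun x => ?_⟩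
  set a := ‖f x‖ with ha
  rcases (norm_nonneg (f x)).eq_or_lt with h0 | h0
  · rw [ha, ← h0]; positivity
  rw [← ha] at h0
  set ρ := a / (2 * M) with hρ
  have hρ0 : 0 < ρ := by positivity
  have hρ1 : ρ ≤ 1 := by
    rw [hρ, div_le_one (by positivity)]
    have := hfM x
    linarith
  set c := Real.exp (r * (N + 1) * (sumWeight ω x - A)) * (a / 2) with hc
  have hball : ∀ y ∈ Metric.ball x ρ, c ≤ Real.exp (s * sumWeight ω y) * ‖f y‖ := by
    intro y hy
    have hy' : ‖x - y‖ < ρ := by rwa [← dist_eq_norm, dist_comm]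
    have h1 := hKA x y (hy'.le.trans hρ1)
    have h2 : a / 2 ≤ ‖f y‖ := by
      have h3 := hfL x y
      have h4 : M * ‖x - y‖ ≤ a / 2 := by
        calc M * ‖x - y‖ ≤ M * ρ := by gcongr
          _ = a / 2 := by rw [hρ]; field_simp
      have h5 := norm_sub_norm_le (f x) (f y)
      linarith
    have h3 : r * (N + 1) * (sumWeight ω x - A) ≤ s * sumWeight ω y := by
      rw [hs, mul_comm K, mul_assoc _ K]
      exact mul_le_mul_of_nonneg_left (by linarith) (by positivity)
    rw [hc]
    gcongr
  have h1 : c * volume.real (Metric.ball x ρ) ≤ I := by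
    calc c * volume.real (Metric.ball x ρ)
        ≤ ∫ y in Metric.ball x ρ, Real.exp (s * sumWeight ω y) * ‖f y‖ := by
          have := setIntegral_mono_on (μ := volume) (s := Metric.ball x ρ) (f := fun _ => c)
            (integrableOn_const measure_ball_lt_top.ne)
            (hf s hs0).integrableOn measurableSet_ball hball
          simpa [mul_comm] using this
      _ ≤ I := setIntegral_le_integral (hf s hs0) (Eventually.of_forall fun y => by positivity)
  have h2 : volume.real (Metric.ball x ρ) = ρ ^ N * v := by
    rw [hv, Measure.real, Measure.addHaar_ball_of_pos _ _ hρ0, ENNReal.toReal_mul, Measure.real,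
      ENNReal.toReal_ofReal (by positivity)]
    simp
  have h3 : a ^ (N + 1) ≤ C * Real.exp (-(r * sumWeight ω x)) ^ (N + 1) := by
    rw [h2, hc, hρ, div_pow] at h1
    rw [hC, div_mul_eq_mul_div, le_div_iff₀ hv0, ← Real.exp_nat_mul]
    have h4 : Real.exp (r * (N + 1) * (sumWeight ω x - A)) *
        (Real.exp (r * (N + 1) * A) * Real.exp (((N + 1 : ℕ) : ℝ) * -(r * sumWeight ω x))) = 1 := by
      rw [← Real.exp_add, ← Real.exp_add, Real.exp_eq_one_iff]
      push_cast
      ring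
    set e₁ := Real.exp (r * (N + 1) * (sumWeight ω x - A))
    set e₂ := Real.exp (r * (N + 1) * A)
    set e₃ := Real.exp (((N + 1 : ℕ) : ℝ) * -(r * sumWeight ω x))
    have h6 : (e₁ * (a / 2) * (a ^ N / (2 * M) ^ N * v)) * (2 * (2 * M) ^ N * (e₂ * e₃)) =
        a ^ (N + 1) * v * (e₁ * (e₂ * e₃)) := by
      field_simp
      ring
    calc a ^ (N + 1) * v = (e₁ * (a / 2) * (a ^ N / (2 * M) ^ N * v)) *
          (2 * (2 * M) ^ N * (e₂ * e₃)) := by rw [h6, h4, mul_one]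
      _ ≤ I * (2 * (2 * M) ^ N * (e₂ * e₃)) := by gcongr
      _ = _ := by ring
  refine le_of_pow_le_pow_left₀ (Nat.succ_ne_zero N) (by positivity) ?_
  rw [mul_pow]
  refine h3.trans ?_
  gcongr
  exact (le_max_right 1 C).trans (le_self_pow₀ (le_max_left _ _) (Nat.succ_ne_zero N))

lemma integrable_exp_mul_of_eLpNorm_lt_top (hω : ∀ j, IsWeightFunction (ω j)) {p : ℝ≥0∞}
    (hp : 1 ≤ p) {g : EuclideanSpace ℝ (Fin N) → ℂ} (hg : Continuous g)
    (h : ∀ r : ℝ, 0 < r →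
      eLpNorm (fun x => (Real.exp (r * sumWeight ω x) : ℂ) * g x) p volume < ∞) {r : ℝ}
    (hr : 0 < r) : Integrable (fun x => Real.exp (r * sumWeight ω x) * ‖g x‖) := by
  obtain ⟨A, hA, hH⟩ := exists_eLpNorm_one_inv_polyWeight_mul_le (N := N) hp
  obtain ⟨B, c, hB, hc, hBc⟩ := polyWeight_le_exp_sumWeight hω
  have hcont := continuous_sumWeight hω
  have hm : Continuous fun x => (Real.exp ((r + c) * sumWeight ω x) : ℂ) * g x := by fun_prop
  have h1 := (hH _ hm.aestronglyMeasurable).trans_lt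
    (ENNReal.mul_lt_top ENNReal.ofReal_lt_top (h (r + c) (by positivity)))
  have hm2 : Continuous fun x => (((polyWeight x)⁻¹ : ℝ) : ℂ) *
      ((Real.exp ((r + c) * sumWeight ω x) : ℂ) * g x) :=
    (Complex.continuous_ofReal.comp continuous_inv_polyWeight).mul hm
  have h2 : Integrable (fun x => (((polyWeight x)⁻¹ : ℝ) : ℂ) *
      ((Real.exp ((r + c) * sumWeight ω x) : ℂ) * g x)) :=
    memLp_one_iff_integrable.1 ⟨hm2.aestronglyMeasurable, h1⟩
  refine (h2.norm.const_mul B).mono' (by fun_prop) (Eventually.of_forall fun x => ?_)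
  have hw := polyWeight_pos x
  simp only [norm_mul, norm_norm, Complex.norm_real, Real.norm_of_nonneg (Real.exp_pos _).le,
    Real.norm_of_nonneg (inv_pos.2 hw).le]
  rw [← mul_assoc, ← mul_assoc]
  gcongr
  rw [add_mul, Real.exp_add, mul_comm (Real.exp (r * _)), ← mul_assoc]
  refine le_mul_of_one_le_left (Real.exp_pos _).le ?_
  rw [mul_right_comm, ← div_eq_mul_inv, le_div_iff₀ hw, one_mul]
  exact hBc x

lemma rapidDecay_of_eLpNorm_lt_top (hω : ∀ j, IsWeightFunction (ω j)) {p : ℝ≥0∞}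
    (hp : 1 ≤ p) (f : 𝓢(EuclideanSpace ℝ (Fin N), ℂ))
    (h : ∀ r : ℝ, 0 < r →
      eLpNorm (fun x => (Real.exp (r * sumWeight ω x) : ℂ) * f x) p volume < ∞) :
    RapidDecay ω f :=
  rapidDecay_of_integrable hω f fun _ hr =>
    integrable_exp_mul_of_eLpNorm_lt_top hω hp f.continuous h hr

open LineDeriv in
-- A difference quotient with step h = exp(-rΩ(x)): the increment of f is O(h²) by decay at rate 2r
-- and the Taylor remainder is O(h²), so the derivative is O(h).
lemma RapidDecay.lineDerivOp (hω : ∀ j, IsWeightFunction (ω j))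
    {f : 𝓢(EuclideanSpace ℝ (Fin N), ℂ)} (hf : RapidDecay ω f) {v : EuclideanSpace ℝ (Fin N)}
    (hv : ‖v‖ ≤ 1) : RapidDecay ω (∂_{v} f : 𝓢(EuclideanSpace ℝ (Fin N), ℂ)) := by
  intro r hr
  obtain ⟨M, hM, -, hfL⟩ := (∂_{v} f : 𝓢(EuclideanSpace ℝ (Fin N), ℂ)).exists_norm_le_and_norm_sub_le
  obtain ⟨K, A, hK, hA, hKA⟩ := sumWeight_le_of_norm_sub_le_one hω
  obtain ⟨C, hC, hfC⟩ := hf (2 * r * K) (by positivity)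
  refine ⟨2 * C * Real.exp (2 * r * A) + M, by positivity, fun x => ?_⟩
  set h := Real.exp (-(r * sumWeight ω x)) with hh
  have hh0 : 0 < h := Real.exp_pos _
  have hh1 : h ≤ 1 := Real.exp_le_one_iff.2 (by
    have := sumWeight_nonneg hω x
    simp only [Left.neg_nonpos_iff]; positivity)
  set D := (∂_{v} f : 𝓢(EuclideanSpace ℝ (Fin N), ℂ)) with hD
  have hder : ∀ t : ℝ, HasDerivAt (fun t : ℝ => f (x + t • v)) (D (x + t • v)) t := by
    intro t
    have h1 := (f.differentiableAt (x := x + t • v)).hasFDerivAt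
    have h2 : HasDerivAt (fun t : ℝ => x + t • v) v t := by
      simpa using ((hasDerivAt_id t).smul_const v).const_add x
    have := h1.comp_hasDerivAt t h2
    rwa [hD, SchwartzMap.lineDerivOp_apply_eq_fderiv]
  have hsmall : ∀ t : ℝ, 0 ≤ t → t ≤ 1 → ‖f (x + t • v)‖ ≤ C * Real.exp (2 * r * A) * h ^ 2 := by
    intro t ht ht1
    refine (hfC _).trans ?_
    rw [mul_assoc C, hh, ← Real.exp_nat_mul, ← Real.exp_add]
    gcongr
    have h1 := hKA x (x + t • v) (by
      simp only [sub_add_cancel_left, norm_neg, norm_smul, Real.norm_of_nonneg ht]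
      nlinarith [norm_nonneg v])
    have : r * sumWeight ω x ≤ r * (K * sumWeight ω (x + t • v) + A) := by gcongr
    push_cast
    linarith
  have htaylor : ‖(f (x + h • v) - h • D x) - (f (x + (0 : ℝ) • v) - (0 : ℝ) • D x)‖ ≤
      (M * h) * ‖h - 0‖ := by
    refine Convex.norm_image_sub_le_of_norm_hasDerivWithin_le (𝕜 := ℝ) (s := Set.Icc 0 h)
      (f := fun t : ℝ => f (x + t • v) - t • D x) (f' := fun t => D (x + t • v) - D x)
      (fun t _ => ?_) (fun t ht => ?_) (convex_Icc 0 h) (Set.left_mem_Icc.2 hh0.le)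
      (Set.right_mem_Icc.2 hh0.le)
    · have h1 : HasDerivAt (fun t : ℝ => t • D x) (D x) t := by
        simpa using (hasDerivAt_id t).smul_const (D x)
      exact ((hder t).sub h1).hasDerivWithinAt
    · refine (hfL _ _).trans ?_
      gcongr
      rw [add_sub_cancel_left, norm_smul, Real.norm_of_nonneg ht.1]
      nlinarith [norm_nonneg v, ht.1, ht.2]
  have h1 := hsmall h hh0.le hh1
  have h2 := hsmall 0 le_rfl zero_le_one
  have h3 : h * ‖D x‖ ≤ h * ((2 * C * Real.exp (2 * r * A) + M) * h) := by
    have h4 : h • D x = (f (x + h • v) - f (x + (0 : ℝ) • v)) -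
        ((f (x + h • v) - h • D x) - (f (x + (0 : ℝ) • v) - (0 : ℝ) • D x)) := by
      rw [zero_smul ℝ (D x)]; abel
    have h5 : ‖h • D x‖ = h * ‖D x‖ := by rw [norm_smul, Real.norm_of_nonneg hh0.le]
    have h6 : ‖h - 0‖ = h := by rw [sub_zero, Real.norm_of_nonneg hh0.le]
    rw [h6] at htaylor
    rw [← h5, h4]
    refine (norm_sub_le _ _).trans ?_
    have := norm_sub_le (f (x + h • v)) (f (x + (0 : ℝ) • v))
    nlinarith
  exact le_of_mul_le_mul_left h3 hh0

open LineDeriv in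
lemma RapidDecay.iteratedLineDerivOp (hω : ∀ j, IsWeightFunction (ω j)) {n : ℕ}
    (m : Fin n → EuclideanSpace ℝ (Fin N)) (hm : ∀ i, ‖m i‖ ≤ 1)
    {f : 𝓢(EuclideanSpace ℝ (Fin N), ℂ)} (hf : RapidDecay ω f) :
    RapidDecay ω (∂^{m} f : 𝓢(EuclideanSpace ℝ (Fin N), ℂ)) := by
  induction n with
  | zero => simpa using hf
  | succ n ih =>
    rw [iteratedLineDerivOp_succ_left]
    exact (ih (Fin.tail m) fun i => hm _).lineDerivOp hω (hm 0)

end RapidDecay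

/-! ### Multi-index derivatives as iterated directional derivatives. -/

section MultiDeriv

variable {N : ℕ}

/-- The directions of differentiation in `multiDeriv α`. -/
noncomputable def multiDir (α : Fin N → ℕ) (i : Fin (∑ j, α j)) : EuclideanSpace ℝ (Fin N) :=
  EuclideanSpace.single (finSigmaFinEquiv.symm i).1 (1 : ℝ)

lemma norm_multiDir (α : Fin N → ℕ) (i : Fin (∑ j, α j)) : ‖multiDir α i‖ = 1 := by
  simp [multiDir]

open LineDeriv in
lemma multiDeriv_eq (α : Fin N → ℕ) (f : 𝓢(EuclideanSpace ℝ (Fin N), ℂ))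
    (x : EuclideanSpace ℝ (Fin N)) :
    multiDeriv α f x = (-Complex.I) ^ (∑ j, α j) *
      (∂^{multiDir α} f : 𝓢(EuclideanSpace ℝ (Fin N), ℂ)) x := by
  rw [SchwartzMap.iteratedLineDerivOp_eq_iteratedFDeriv]; rfl

open LineDeriv in
lemma norm_multiDeriv (α : Fin N → ℕ) (f : 𝓢(EuclideanSpace ℝ (Fin N), ℂ))
    (x : EuclideanSpace ℝ (Fin N)) :
    ‖multiDeriv α f x‖ = ‖(∂^{multiDir α} f : 𝓢(EuclideanSpace ℝ (Fin N), ℂ)) x‖ := by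
  simp [multiDeriv_eq]

lemma continuous_multiDeriv (α : Fin N → ℕ) (f : 𝓢(EuclideanSpace ℝ (Fin N), ℂ)) :
    Continuous (multiDeriv α f) := by
  simp_rw [funext (multiDeriv_eq α f)]
  exact continuous_const.mul (SchwartzMap.continuous _)

lemma multiDeriv_zero (f : EuclideanSpace ℝ (Fin N) → ℂ) : multiDeriv 0 f = f := by
  ext x
  -- The order is generalised since it equals 0 only propositionally and the type of m depends on
  -- it.
  have h : ∀ n : ℕ, n = 0 → ∀ m : Fin n → EuclideanSpace ℝ (Fin N),
      (-Complex.I) ^ n * iteratedFDeriv ℝ n f x m = f x := by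
    rintro n rfl m
    simp
  exact h _ (by simp) _

lemma RapidDecay.multiDeriv_schwartzMap {ω : Fin N → ℝ → ℝ} (hω : ∀ j, IsWeightFunction (ω j))
    {f : 𝓢(EuclideanSpace ℝ (Fin N), ℂ)} (hf : RapidDecay ω f) (α : Fin N → ℕ) :
    RapidDecay ω (multiDeriv α f) := by
  intro r hr
  simp_rw [norm_multiDeriv]
  exact hf.iteratedLineDerivOp hω _ (fun i => (norm_multiDir α i).le) r hr

/-- Evaluating a multiplicative expression along the directions of `multiDeriv α`. -/
lemma prod_multiDir {M : Type*} [CommMonoid M] (α : Fin N → ℕ) (φ : Fin N → M) :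
    ∏ i : Fin (∑ j, α j), φ (finSigmaFinEquiv.symm i).1 = ∏ j, φ j ^ α j := by
  rw [← Equiv.prod_comp finSigmaFinEquiv, Fintype.prod_sigma]
  simp

end MultiDeriv

/-! ### Gaussians against weights. -/

section Gaussian

variable {N : ℕ}

lemma IsWeightFunction.exists_le_add {ω : ℝ → ℝ} (h : IsWeightFunction ω) :
    ∃ A : ℝ, 0 ≤ A ∧ ∀ x : ℝ, 0 ≤ x → ω x ≤ A + x := by
  have h1 := h.isLittleO_id.bound (zero_lt_one)
  obtain ⟨x₀, hx₀⟩ := eventually_atTop.1 h1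
  refine ⟨ω (max x₀ 0), h.nonneg _ (le_max_right _ _), fun x hx => ?_⟩
  rcases le_total x (max x₀ 0) with h2 | h2
  · have := h.monotoneOn hx (Set.mem_Ici.2 (le_max_right x₀ 0)) h2
    linarith
  · have h3 := hx₀ x ((le_max_left _ _).trans h2)
    rw [one_mul, Real.norm_of_nonneg hx] at h3
    have := (le_abs_self _).trans h3
    have := h.nonneg _ (le_max_right x₀ 0)
    linarith

lemma sumWeight_le_add_norm {ω : Fin N → ℝ → ℝ} (hω : ∀ j, IsWeightFunction (ω j)) :
    ∃ A : ℝ, 0 ≤ A ∧ ∀ x : EuclideanSpace ℝ (Fin N), sumWeight ω x ≤ A + N * ‖x‖ := by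
  choose A hA h using fun j => (hω j).exists_le_add
  refine ⟨∑ j, A j, Finset.sum_nonneg fun j _ => hA j, fun x => ?_⟩
  calc sumWeight ω x ≤ ∑ j, (A j + ‖x‖) := by
        refine Finset.sum_le_sum fun j _ => (h j _ (abs_nonneg _)).trans ?_
        gcongr
        exact PiLp.norm_apply_le x j
    _ = _ := by simp [Finset.sum_add_distrib]

lemma integrable_exp_norm_mul_gaussian (B : ℝ) :
    Integrable (fun s : EuclideanSpace ℝ (Fin N) =>
      Real.exp (B * ‖s‖) * Real.exp (-(Real.pi * ‖s‖ ^ 2))) := by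
  have h1 : Integrable (fun s : EuclideanSpace ℝ (Fin N) =>
      Complex.exp (-(1 : ℂ) * ‖s‖ ^ 2 + 0 * ((inner ℝ (0 : EuclideanSpace ℝ (Fin N)) s : ℝ) : ℂ))) :=
    GaussianFourier.integrable_cexp_neg_mul_sq_norm_add (by simp) _ _
  refine (h1.norm.const_mul (Real.exp (B ^ 2 / 2))).mono' (by fun_prop)
    (Eventually.of_forall fun s => ?_)
  rw [Real.norm_of_nonneg (by positivity), Complex.norm_exp, ← Real.exp_add, ← Real.exp_add]
  apply Real.exp_le_exp.2
  have h2 : (-(1 : ℂ) * ‖s‖ ^ 2 +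
      0 * ((inner ℝ (0 : EuclideanSpace ℝ (Fin N)) s : ℝ) : ℂ)).re = -‖s‖ ^ 2 := by
    simp [← Complex.ofReal_pow]
  rw [h2]
  nlinarith [sq_nonneg (B - ‖s‖), Real.pi_gt_three, sq_nonneg ‖s‖]

lemma integrable_exp_sumWeight_mul_gaussian {ω : Fin N → ℝ → ℝ}
    (hω : ∀ j, IsWeightFunction (ω j)) {r : ℝ} (hr : 0 ≤ r) :
    Integrable (fun s : EuclideanSpace ℝ (Fin N) =>
      Real.exp (r * sumWeight ω s) * Real.exp (-(Real.pi * ‖s‖ ^ 2))) := by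
  obtain ⟨A, hA, h⟩ := sumWeight_le_add_norm hω
  have hc := continuous_sumWeight hω
  refine ((integrable_exp_norm_mul_gaussian (r * N)).const_mul (Real.exp (r * A))).mono'
    (by fun_prop) (Eventually.of_forall fun s => ?_)
  rw [Real.norm_of_nonneg (by positivity), ← mul_assoc, ← Real.exp_add (r * A)]
  gcongr
  calc r * sumWeight ω s ≤ r * (A + N * ‖s‖) := by gcongr; exact h s
    _ = _ := by ring

/-- Convolution with a Gaussian preserves rapid decay: split Ω(x) between y and x - y. The second
share has at most linear growth in the exponent by (β), which the Gaussian absorbs. -/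
lemma RapidDecay.integral_mul_gaussian_le {ω : Fin N → ℝ → ℝ} (hω : ∀ j, IsWeightFunction (ω j))
    {g : EuclideanSpace ℝ (Fin N) → ℂ} (hg : RapidDecay ω g) {r : ℝ} (hr : 0 < r) :
    ∃ C : ℝ, 0 < C ∧ ∀ x, ∫ y, ‖g y‖ * Real.exp (-(Real.pi * ‖x - y‖ ^ 2)) ≤
      C * Real.exp (-(r * sumWeight ω x)) := by
  obtain ⟨K, hK, hKx⟩ := sumWeight_le_of_abs_le_add hω
  obtain ⟨C, hC, hgC⟩ := hg (r * K) (by positivity)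
  have hint := integrable_exp_sumWeight_mul_gaussian hω (r := r * K) (by positivity)
  set I := ∫ s : EuclideanSpace ℝ (Fin N),
    Real.exp (r * K * sumWeight ω s) * Real.exp (-(Real.pi * ‖s‖ ^ 2)) with hI
  have hI0 : 0 ≤ I := integral_nonneg fun s => by positivity
  refine ⟨C * Real.exp (r * K) * (I + 1), by positivity, fun x => ?_⟩
  have hbound : ∀ y, ‖g y‖ * Real.exp (-(Real.pi * ‖x - y‖ ^ 2)) ≤
      C * Real.exp (r * K) * Real.exp (-(r * sumWeight ω x)) *
        (Real.exp (r * K * sumWeight ω (x - y)) * Real.exp (-(Real.pi * ‖x - y‖ ^ 2))) := by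
    intro y
    rw [← mul_assoc]
    gcongr
    refine (hgC y).trans ?_
    rw [mul_assoc C, mul_assoc C, ← Real.exp_add, ← Real.exp_add]
    gcongr
    have h1 := hKx x y (x - y) fun j => by simpa using abs_add_le (y j) (x j - y j)
    have h2 : r * sumWeight ω x ≤ r * (K * (1 + sumWeight ω y + sumWeight ω (x - y))) := by gcongr
    linarith
  calc _ ≤ ∫ y, C * Real.exp (r * K) * Real.exp (-(r * sumWeight ω x)) *
        (Real.exp (r * K * sumWeight ω (x - y)) * Real.exp (-(Real.pi * ‖x - y‖ ^ 2))) :=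
        integral_mono_of_nonneg (Eventually.of_forall fun y => by positivity)
          ((hint.comp_sub_left x).const_mul _) (Eventually.of_forall hbound)
    _ = C * Real.exp (r * K) * Real.exp (-(r * sumWeight ω x)) * I := by
        rw [integral_const_mul, integral_sub_left_eq_self (fun s =>
          Real.exp (r * K * sumWeight ω s) * Real.exp (-(Real.pi * ‖s‖ ^ 2)))]
    _ ≤ C * Real.exp (r * K) * Real.exp (-(r * sumWeight ω x)) * (I + 1) := by gcongr; linarith
    _ = _ := by ring

end Gaussian

/-! ### The Gaussian short-time Fourier transform. -/

section ShortTimeFourier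

open FourierTransform

variable {N : ℕ}

/-- `f` multiplied by the Gaussian window centred at `x`. -/
noncomputable def gaussianWindow (f : EuclideanSpace ℝ (Fin N) → ℂ)
    (x y : EuclideanSpace ℝ (Fin N)) : ℂ :=
  (Real.exp (-(Real.pi * ‖x - y‖ ^ 2)) : ℂ) * f y

lemma continuous_gaussianWindow (f : 𝓢(EuclideanSpace ℝ (Fin N), ℂ))
    (x : EuclideanSpace ℝ (Fin N)) : Continuous (gaussianWindow f x) := by
  have := f.continuous
  unfold gaussianWindow
  fun_prop

lemma norm_gaussianWindow (f : EuclideanSpace ℝ (Fin N) → ℂ)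
    (x y : EuclideanSpace ℝ (Fin N)) :
    ‖gaussianWindow f x y‖ = ‖f y‖ * Real.exp (-(Real.pi * ‖x - y‖ ^ 2)) := by
  rw [gaussianWindow, norm_mul, Complex.norm_real, Real.norm_of_nonneg (Real.exp_pos _).le,
    mul_comm]

lemma integrable_gaussianWindow (f : 𝓢(EuclideanSpace ℝ (Fin N), ℂ))
    (x : EuclideanSpace ℝ (Fin N)) : Integrable (gaussianWindow f x) := by
  refine f.integrable.norm.mono' (continuous_gaussianWindow f x).aestronglyMeasurable
    (Eventually.of_forall fun y => ?_)
  rw [norm_gaussianWindow]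
  refine mul_le_of_le_one_right (norm_nonneg _) (Real.exp_le_one_iff.2 ?_)
  simp only [Left.neg_nonpos_iff]
  positivity

lemma norm_fourier_gaussianWindow_le (f : EuclideanSpace ℝ (Fin N) → ℂ)
    (x ξ : EuclideanSpace ℝ (Fin N)) :
    ‖𝓕 (gaussianWindow f x) ξ‖ ≤ ∫ y, ‖f y‖ * Real.exp (-(Real.pi * ‖x - y‖ ^ 2)) := by
  simp_rw [← norm_gaussianWindow]
  exact VectorFourier.norm_fourierIntegral_le_integral_norm _ _ _ _ _

lemma continuous_fourier_gaussianWindow (f : 𝓢(EuclideanSpace ℝ (Fin N), ℂ))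
    (x : EuclideanSpace ℝ (Fin N)) : Continuous (𝓕 (gaussianWindow f x)) :=
  VectorFourier.fourierIntegral_continuous (L := innerₗ (EuclideanSpace ℝ (Fin N)))
    Real.continuous_fourierChar continuous_inner (integrable_gaussianWindow f x)

/-- The frequency-side counterpart of `norm_fourier_gaussianWindow_le`: the window is itself the
Fourier transform of a modulated Gaussian, so moving the transform across the integral puts it on
`f`. -/
lemma norm_fourier_gaussianWindow_le' (f : 𝓢(EuclideanSpace ℝ (Fin N), ℂ))
    (x ξ : EuclideanSpace ℝ (Fin N)) :
    ‖𝓕 (gaussianWindow f x) ξ‖ ≤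
      ∫ y, ‖𝓕 (f : EuclideanSpace ℝ (Fin N) → ℂ) y‖ * Real.exp (-(Real.pi * ‖ξ - y‖ ^ 2)) := by
  set k : EuclideanSpace ℝ (Fin N) → ℂ := fun v =>
    Complex.exp (-(Real.pi : ℂ) * ‖v‖ ^ 2 + 2 * Real.pi * Complex.I * (inner ℝ x v : ℝ)) with hk
  have hkint : Integrable k :=
    GaussianFourier.integrable_cexp_neg_mul_sq_norm_add (by simpa using Real.pi_pos) _ _
  have hkhat : ∀ w, 𝓕 k w = (Real.exp (-(Real.pi * ‖x - w‖ ^ 2)) : ℂ) := by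
    intro w
    have hpi : (Real.pi : ℂ) ≠ 0 := by exact_mod_cast Real.pi_ne_zero
    rw [hk, fourier_gaussian_innerProductSpace' (by simpa using Real.pi_pos), div_self hpi,
      Complex.one_cpow, one_mul, Complex.ofReal_exp]
    congr 1
    push_cast
    field_simp
  set F : EuclideanSpace ℝ (Fin N) → ℂ := fun y => Real.fourierChar (-inner ℝ y ξ) • f y with hF
  have hFint : Integrable F :=
    (Real.fourierIntegral_convergent_iff (μ := volume) (f := f) ξ).2 f.integrable
  have hFhat : ∀ v, 𝓕 F v = 𝓕 (f : EuclideanSpace ℝ (Fin N) → ℂ) (v + ξ) := by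
    intro v
    rw [Real.fourier_eq, Real.fourier_eq]
    refine integral_congr_ae (Eventually.of_forall fun y => ?_)
    simp only [hF]
    rw [smul_smul, ← AddChar.map_add_eq_mul, inner_add_right]
    congr 2
    ring
  have hswap : ∫ v, 𝓕 F v • k v = ∫ y, F y • 𝓕 k y := by
    simpa using! VectorFourier.integral_fourierIntegral_smul_eq_flip
      (L := innerₗ (EuclideanSpace ℝ (Fin N))) Real.continuous_fourierChar continuous_inner
      hFint hkint
  have hV : 𝓕 (gaussianWindow f x) ξ = ∫ v, 𝓕 F v • k v := by
    rw [hswap, Real.fourier_eq]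
    refine integral_congr_ae (Eventually.of_forall fun y => ?_)
    simp only [hF, hkhat, gaussianWindow, Circle.smul_def, smul_eq_mul]
    ring
  rw [hV]
  refine (norm_integral_le_integral_norm _).trans (le_of_eq ?_)
  have hnk : ∀ v, ‖k v‖ = Real.exp (-(Real.pi * ‖v‖ ^ 2)) := by
    intro v
    rw [hk, Complex.norm_exp]
    congr 1
    simp [← Complex.ofReal_pow]
  rw [← integral_sub_right_eq_self (fun v => ‖𝓕 F v • k v‖) ξ]
  refine integral_congr_ae (Eventually.of_forall fun v => ?_)
  simp only [norm_smul, hFhat, hnk, sub_add_cancel, norm_sub_rev ξ v]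

/-- The Gaussian short-time Fourier transform inherits the decay of `f` and of `𝓕 f`. -/
lemma exists_norm_fourier_gaussianWindow_le {ω σ : Fin N → ℝ → ℝ}
    (hω : ∀ j, IsWeightFunction (ω j)) (hσ : ∀ j, IsWeightFunction (σ j))
    (f : 𝓢(EuclideanSpace ℝ (Fin N), ℂ)) (hf : RapidDecay ω f)
    (hf' : RapidDecay σ (𝓕 (f : EuclideanSpace ℝ (Fin N) → ℂ))) {r s : ℝ} (hr : 0 < r)
    (hs : 0 < s) :
    ∃ C : ℝ, 0 < C ∧ ∀ x ξ, ‖𝓕 (gaussianWindow f x) ξ‖ ≤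
      C * Real.exp (-(r * sumWeight ω x)) * Real.exp (-(s * sumWeight σ ξ)) := by
  -- Rates are doubled because the two bounds on V are multiplied and a square root is taken.
  obtain ⟨C, hC, h⟩ := hf.integral_mul_gaussian_le hω (r := 2 * r) (by positivity)
  obtain ⟨D, hD, h'⟩ := hf'.integral_mul_gaussian_le hσ (r := 2 * s) (by positivity)
  refine ⟨C + D, by positivity, fun x ξ => ?_⟩
  have h1 := (norm_fourier_gaussianWindow_le f x ξ).trans (h x)
  have h2 := (norm_fourier_gaussianWindow_le' f x ξ).trans (h' ξ)
  set V := ‖𝓕 (gaussianWindow f x) ξ‖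
  have e1 : Real.exp (-(2 * r * sumWeight ω x)) = Real.exp (-(r * sumWeight ω x)) ^ 2 := by
    rw [← Real.exp_nat_mul]; congr 1; push_cast; ring
  have e2 : Real.exp (-(2 * s * sumWeight σ ξ)) = Real.exp (-(s * sumWeight σ ξ)) ^ 2 := by
    rw [← Real.exp_nat_mul]; congr 1; push_cast; ring
  rw [e1] at h1
  rw [e2] at h2
  have p1 := Real.exp_pos (-(r * sumWeight ω x))
  have p2 := Real.exp_pos (-(s * sumWeight σ ξ))
  set a := Real.exp (-(r * sumWeight ω x))
  set b := Real.exp (-(s * sumWeight σ ξ))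
  have hV : 0 ≤ V := norm_nonneg _
  refine le_of_sq_le_sq ?_ (by positivity)
  calc V ^ 2 = V * V := sq V
    _ ≤ (C * a ^ 2) * (D * b ^ 2) := by gcongr
    _ = (C * D) * (a * b) ^ 2 := by ring
    _ ≤ (C + D) ^ 2 * (a * b) ^ 2 := by gcongr; nlinarith
    _ = _ := by ring

end ShortTimeFourier

/-! ### Differentiating superpositions of exponentials. -/

section Superposition

variable {E : Type*} [NormedAddCommGroup E] [InnerProductSpace ℝ E]

/-- The exponent `2πi⟨ξ, y⟩ + 2π⟨s, y⟩`. -/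
noncomputable def expPhase (θ : E × E) (y : E) : ℂ :=
  2 * Real.pi * Complex.I * (inner ℝ θ.1 y : ℝ) + 2 * Real.pi * (inner ℝ θ.2 y : ℝ)

lemma expPhase_add_smul (θ : E × E) (y v : E) (t : ℝ) :
    expPhase θ (y + t • v) = expPhase θ y + t * expPhase θ v := by
  simp only [expPhase, inner_add_right, inner_smul_right]
  push_cast
  ring

lemma re_expPhase (θ : E × E) (y : E) : (expPhase θ y).re = 2 * Real.pi * inner ℝ θ.2 y := by
  simp [expPhase]

lemma norm_expPhase_le (θ : E × E) (y : E) :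
    ‖expPhase θ y‖ ≤ 2 * Real.pi * (|inner ℝ θ.1 y| + |inner ℝ θ.2 y|) := by
  refine (norm_add_le _ _).trans (le_of_eq ?_)
  simp [abs_of_pos Real.pi_pos]
  ring

/-- In this product form, one factor of the phase raises n by exactly one in `ExpIntegrable`. -/
lemma norm_expPhase_le' (θ : E × E) (y : E) :
    ‖expPhase θ y‖ ≤ 2 * Real.pi * ‖y‖ * ((1 + ‖θ.1‖) * Real.exp ‖θ.2‖) := by
  refine (norm_expPhase_le θ y).trans ?_
  have h1 := abs_real_inner_le_norm θ.1 y
  have h2 := abs_real_inner_le_norm θ.2 y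
  have h3 := Real.add_one_le_exp ‖θ.2‖
  have h4 : ‖θ.1‖ + ‖θ.2‖ ≤ (1 + ‖θ.1‖) * Real.exp ‖θ.2‖ := by
    nlinarith [norm_nonneg θ.1, norm_nonneg θ.2, mul_nonneg (norm_nonneg θ.1) (norm_nonneg θ.2)]
  calc 2 * Real.pi * (|inner ℝ θ.1 y| + |inner ℝ θ.2 y|)
      ≤ 2 * Real.pi * (‖θ.1‖ * ‖y‖ + ‖θ.2‖ * ‖y‖) := by gcongr
    _ = 2 * Real.pi * ‖y‖ * (‖θ.1‖ + ‖θ.2‖) := by ring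
    _ ≤ _ := by gcongr

lemma continuous_expPhase (y : E) : Continuous (fun θ : E × E => expPhase θ y) := by
  unfold expPhase; fun_prop

/-- Densities for which the superposition of the exponentials `exp (expPhase θ y)` may be
differentiated under the integral sign arbitrarily often. -/
def ExpIntegrable [MeasurableSpace E] (ν : Measure (E × E)) (h : E × E → ℂ) : Prop :=
  AEStronglyMeasurable h ν ∧
    ∀ n : ℕ, Integrable (fun θ => ‖h θ‖ * ((1 + ‖θ.1‖) ^ n * Real.exp (n * ‖θ.2‖))) ν

variable [MeasurableSpace E] [BorelSpace E] [SecondCountableTopology E]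

lemma ExpIntegrable.mul_expPhase {ν : Measure (E × E)} {h : E × E → ℂ} (hh : ExpIntegrable ν h)
    (v : E) : ExpIntegrable ν (fun θ => expPhase θ v * h θ) := by
  refine ⟨(continuous_expPhase v).aestronglyMeasurable.mul hh.1, fun n => ?_⟩
  have hm : AEStronglyMeasurable
      (fun θ : E × E => (1 + ‖θ.1‖) ^ n * Real.exp (n * ‖θ.2‖)) ν :=
    Continuous.aestronglyMeasurable (by fun_prop)
  refine ((hh.2 (n + 1)).const_mul (2 * Real.pi * ‖v‖)).mono'
    (((continuous_expPhase v).aestronglyMeasurable.mul hh.1).norm.mul hm)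
    (Eventually.of_forall fun θ => ?_)
  rw [Real.norm_of_nonneg (by positivity), norm_mul]
  calc _ ≤ (2 * Real.pi * ‖v‖ * ((1 + ‖θ.1‖) * Real.exp ‖θ.2‖)) * ‖h θ‖ *
        ((1 + ‖θ.1‖) ^ n * Real.exp (n * ‖θ.2‖)) := by
        gcongr; exact norm_expPhase_le' θ v
    _ = _ := by
        push_cast
        rw [add_mul (n : ℝ), one_mul, Real.exp_add]
        ring

lemma ExpIntegrable.hasDerivAt {ν : Measure (E × E)} {h : E × E → ℂ} (hh : ExpIntegrable ν h)
    (y v : E) :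
    HasDerivAt (fun t : ℝ => ∫ θ, h θ * Complex.exp (expPhase θ (y + t • v)) ∂ν)
      (∫ θ, (expPhase θ v * h θ) * Complex.exp (expPhase θ y) ∂ν) 0 := by
  -- This n dominates the growth of the exponentials for all |t| < 1 at once.
  obtain ⟨n, hn⟩ := exists_nat_ge (2 * Real.pi * (‖y‖ + ‖v‖))
  have hexp : ∀ t ∈ Metric.ball (0 : ℝ) 1, ∀ θ : E × E,
      ‖Complex.exp (expPhase θ (y + t • v))‖ ≤ (1 + ‖θ.1‖) ^ n * Real.exp (n * ‖θ.2‖) := by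
    intro t ht θ
    rw [Complex.norm_exp, re_expPhase]
    have h1 : (1 : ℝ) ≤ (1 + ‖θ.1‖) ^ n := one_le_pow₀ (by linarith [norm_nonneg θ.1])
    refine le_trans (Real.exp_le_exp.2 ?_) (le_mul_of_one_le_left (Real.exp_pos _).le h1)
    have ht' : |t| < 1 := by simpa using ht
    have h2 : ‖y + t • v‖ ≤ ‖y‖ + ‖v‖ := by
      refine (norm_add_le _ _).trans ?_
      gcongr
      rw [norm_smul, Real.norm_eq_abs]
      exact mul_le_of_le_one_left (norm_nonneg _) ht'.le
    calc 2 * Real.pi * inner ℝ θ.2 (y + t • v)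
        ≤ 2 * Real.pi * (‖θ.2‖ * (‖y‖ + ‖v‖)) := by
          gcongr
          exact (real_inner_le_norm _ _).trans (by gcongr)
      _ = 2 * Real.pi * (‖y‖ + ‖v‖) * ‖θ.2‖ := by ring
      _ ≤ _ := by gcongr
  have hm : ∀ (g : E × E → ℂ), AEStronglyMeasurable g ν → ∀ z : E,
      AEStronglyMeasurable (fun θ => g θ * Complex.exp (expPhase θ z)) ν := fun g hg z =>
    hg.mul (Complex.continuous_exp.comp (continuous_expPhase z)).aestronglyMeasurable
  have h0 : (0 : ℝ) ∈ Metric.ball (0 : ℝ) 1 := by simp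
  have hv := hh.mul_expPhase v
  have key := hasDerivAt_integral_of_dominated_loc_of_deriv_le (μ := ν) (x₀ := (0 : ℝ))
    (s := Metric.ball 0 1)
    (F := fun t θ => h θ * Complex.exp (expPhase θ (y + t • v)))
    (F' := fun t θ => (expPhase θ v * h θ) * Complex.exp (expPhase θ (y + t • v)))
    (bound := fun θ => ‖expPhase θ v * h θ‖ * ((1 + ‖θ.1‖) ^ n * Real.exp (n * ‖θ.2‖)))
    (Metric.ball_mem_nhds _ zero_lt_one)
    (Eventually.of_forall fun t => hm _ hh.1 _)
    ((hh.2 n).mono' (hm _ hh.1 _) (Eventually.of_forall fun θ => by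
      rw [norm_mul]; gcongr; exact hexp 0 h0 θ))
    (hm _ hv.1 _)
    (Eventually.of_forall fun θ t ht => by
      rw [norm_mul]; gcongr; exact hexp t ht θ)
    (hv.2 n)
    (Eventually.of_forall fun θ t _ => by
      have h1 : HasDerivAt (fun t : ℝ => expPhase θ (y + t • v)) (expPhase θ v) t := by
        simp_rw [expPhase_add_smul]
        simpa using ((Complex.ofRealCLM.hasDerivAt (x := t)).mul_const
          (expPhase θ v)).const_add (expPhase θ y)
      have h2 := (h1.cexp).const_mul (h θ)
      exact h2.congr_deriv (by ring))
  simpa using key.2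

open LineDeriv in
lemma ExpIntegrable.iteratedLineDerivOp_eq {ν : Measure (E × E)} {n : ℕ} (m : Fin n → E)
    (f : 𝓢(E, ℂ)) {h : E × E → ℂ} (hh : ExpIntegrable ν h)
    (hf : ∀ y, f y = ∫ θ, h θ * Complex.exp (expPhase θ y) ∂ν) :
    ExpIntegrable ν (fun θ => (∏ i, expPhase θ (m i)) * h θ) ∧
      ∀ y, (∂^{m} f : 𝓢(E, ℂ)) y =
        ∫ θ, ((∏ i, expPhase θ (m i)) * h θ) * Complex.exp (expPhase θ y) ∂ν := by
  induction n with
  | zero => simpa using ⟨hh, hf⟩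
  | succ n ih =>
    obtain ⟨h1, h2⟩ := ih (Fin.tail m)
    have h3 : (fun θ : E × E => (∏ i, expPhase θ (m i)) * h θ) =
        fun θ => expPhase θ (m 0) * ((∏ i, expPhase θ (Fin.tail m i)) * h θ) := by
      ext θ
      rw [Fin.prod_univ_succ, mul_assoc]
      rfl
    rw [h3]
    refine ⟨h1.mul_expPhase _, fun y => ?_⟩
    simp_rw [fun θ => congrFun h3 θ]
    rw [iteratedLineDerivOp_succ_left, SchwartzMap.lineDerivOp_apply]
    refine HasLineDerivAt.lineDeriv ?_
    have h4 := h1.hasDerivAt y (m 0)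
    simp_rw [← h2] at h4
    exact h4

end Superposition

/-! ### The joint estimate in x and α. -/

section MixedEstimate

open FourierTransform LineDeriv

variable {N : ℕ} {ω σ : Fin N → ℝ → ℝ}

lemma one_add_norm_le_polyWeight (x : EuclideanSpace ℝ (Fin N)) :
    1 + ‖x‖ ≤ (N + 1) * polyWeight x := by
  have h1 : ∀ j, |x j| ≤ polyWeight x := fun j => by
    have h2 : 1 + x j ^ 2 ≤ polyWeight x := by
      rw [polyWeight, ← Finset.mul_prod_erase _ _ (Finset.mem_univ j)]
      refine le_mul_of_one_le_right (by positivity) ?_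
      simpa using Finset.prod_le_prod (s := Finset.univ.erase j) (f := fun _ : Fin N => (1 : ℝ))
        (fun _ _ => zero_le_one) (fun j _ => le_add_of_nonneg_right (sq_nonneg (x j)))
    nlinarith [sq_abs (x j), abs_nonneg (x j)]
  have h2 : ‖x‖ ≤ N * polyWeight x := by
    have h3 : x = ∑ j, EuclideanSpace.single j (x j) := by
      ext i; simp [Finset.sum_apply, Pi.single_apply]
    calc ‖x‖ = ‖∑ j, EuclideanSpace.single j (x j)‖ := by rw [← h3]
      _ ≤ ∑ j, ‖EuclideanSpace.single j (x j)‖ := norm_sum_le _ _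
      _ ≤ ∑ _j : Fin N, polyWeight x := by
          refine Finset.sum_le_sum fun j _ => ?_
          simpa using h1 j
      _ = _ := by simp
  have := one_le_polyWeight x
  linarith

/-- The density which represents `f` as a superposition of the exponentials
`exp (expPhase θ y)`, obtained by dividing out the Gaussian window centred at `x`. -/
noncomputable def windowDensity (f : EuclideanSpace ℝ (Fin N) → ℂ)
    (x : EuclideanSpace ℝ (Fin N))
    (θ : EuclideanSpace ℝ (Fin N) × EuclideanSpace ℝ (Fin N)) : ℂ :=
  𝓕 (gaussianWindow f x) θ.1 *
    (Real.exp (-(Real.pi * ‖θ.2‖ ^ 2) - 2 * Real.pi * inner ℝ x θ.2) : ℂ)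

lemma expIntegrable_windowDensity
    (hω : ∀ j, IsWeightFunction (ω j)) (hσ : ∀ j, IsWeightFunction (σ j))
    (f : 𝓢(EuclideanSpace ℝ (Fin N), ℂ)) (hf : RapidDecay ω f)
    (hf' : RapidDecay σ (𝓕 (f : EuclideanSpace ℝ (Fin N) → ℂ)))
    (x : EuclideanSpace ℝ (Fin N)) :
    ExpIntegrable (volume.prod volume) (windowDensity f x) ∧
      Integrable (𝓕 (gaussianWindow f x)) := by
  have hVc := continuous_fourier_gaussianWindow f x
  have hV : ∀ n : ℕ, Integrable (fun ξ => ‖𝓕 (gaussianWindow f x) ξ‖ * (1 + ‖ξ‖) ^ n) := by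
    intro n
    obtain ⟨B, c, hB, hc, hBc⟩ := polyWeight_le_exp_sumWeight hσ
    -- n copies of c pay for (1 + ‖ξ‖)^n, one more for the integrable inverse weight.
    obtain ⟨C, hC, h⟩ := exists_norm_fourier_gaussianWindow_le hω hσ f hf hf'
      (r := 1) (s := c * (n + 1)) one_pos (by positivity)
    refine (integrable_inv_polyWeight.const_mul (C * B ^ (n + 1) * (N + 1) ^ n)).mono'
      (by fun_prop) (Eventually.of_forall fun ξ => ?_)
    have hw := polyWeight_pos ξ
    rw [Real.norm_of_nonneg (by positivity), ← div_eq_mul_inv, le_div_iff₀ hw]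
    have h0 : Real.exp (-(1 * sumWeight ω x)) ≤ 1 := Real.exp_le_one_iff.2 (by
      have := sumWeight_nonneg hω x
      linarith)
    have he : Real.exp (-(c * (n + 1) * sumWeight σ ξ)) *
        Real.exp (c * sumWeight σ ξ) ^ (n + 1) = 1 := by
      rw [← Real.exp_nat_mul, ← Real.exp_add, Real.exp_eq_one_iff]
      push_cast
      ring
    calc _ ≤ (C * 1 * Real.exp (-(c * (n + 1) * sumWeight σ ξ))) *
          ((N + 1) * polyWeight ξ) ^ n * polyWeight ξ := by
          gcongr
          · refine (h x ξ).trans ?_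
            gcongr
          · exact one_add_norm_le_polyWeight ξ
      _ = C * (N + 1) ^ n * Real.exp (-(c * (n + 1) * sumWeight σ ξ)) *
          polyWeight ξ ^ (n + 1) := by rw [mul_pow]; ring
      _ ≤ C * (N + 1) ^ n * Real.exp (-(c * (n + 1) * sumWeight σ ξ)) *
          (B * Real.exp (c * sumWeight σ ξ)) ^ (n + 1) := by
          gcongr
          exact hBc ξ
      _ = C * (N + 1) ^ n * B ^ (n + 1) * (Real.exp (-(c * (n + 1) * sumWeight σ ξ)) *
          Real.exp (c * sumWeight σ ξ) ^ (n + 1)) := by ring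
      _ = _ := by rw [he]; ring
  refine ⟨⟨?_, fun n => ?_⟩, ?_⟩
  · refine Continuous.aestronglyMeasurable ?_
    unfold windowDensity
    fun_prop
  · have h2 : Integrable (fun s : EuclideanSpace ℝ (Fin N) =>
        Real.exp (-(Real.pi * ‖s‖ ^ 2) - 2 * Real.pi * inner ℝ x s) * Real.exp (n * ‖s‖)) := by
      refine (integrable_exp_norm_mul_gaussian (n + 2 * Real.pi * ‖x‖)).mono' (by fun_prop)
        (Eventually.of_forall fun s => ?_)
      rw [Real.norm_of_nonneg (by positivity), ← Real.exp_add, ← Real.exp_add]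
      apply Real.exp_le_exp.2
      have h3 := neg_le_of_abs_le (abs_real_inner_le_norm x s)
      nlinarith [Real.pi_pos]
    refine ((hV n).mul_prod h2).congr (Eventually.of_forall fun θ => ?_)
    simp only [windowDensity, norm_mul, Complex.norm_real,
      Real.norm_of_nonneg (Real.exp_pos _).le]
    ring
  · refine (integrable_norm_iff hVc.aestronglyMeasurable).1 ?_
    simpa using hV 0

/-- Fourier inversion in θ.1 recovers the windowed `f`, while the Gaussian integral in θ.2 equals
exp(π|y - x|²) and cancels the window. -/
lemma eq_integral_windowDensity (f : 𝓢(EuclideanSpace ℝ (Fin N), ℂ))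
    (x : EuclideanSpace ℝ (Fin N)) (hV : Integrable (𝓕 (gaussianWindow f x)))
    (y : EuclideanSpace ℝ (Fin N)) :
    f y = ∫ θ, windowDensity f x θ * Complex.exp (expPhase θ y) ∂(volume.prod volume) := by
  have h1 := congrFun (Continuous.fourierInv_fourier_eq (continuous_gaussianWindow f x)
    (integrable_gaussianWindow f x) hV) y
  rw [Real.fourierInv_eq'] at h1
  have hpi : (Real.pi : ℂ) ≠ 0 := by exact_mod_cast Real.pi_ne_zero
  have h2 := GaussianFourier.integral_cexp_neg_mul_sq_norm_add (b := (Real.pi : ℂ))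
    (by simpa using Real.pi_pos) (2 * Real.pi) (y - x)
  rw [div_self hpi, Complex.one_cpow, one_mul] at h2
  have h3 : ∀ θ : EuclideanSpace ℝ (Fin N) × EuclideanSpace ℝ (Fin N),
      windowDensity f x θ * Complex.exp (expPhase θ y) =
      (Complex.exp (((2 * Real.pi * inner ℝ θ.1 y : ℝ) : ℂ) * Complex.I) •
        𝓕 (gaussianWindow f x) θ.1) *
      Complex.exp (-(Real.pi : ℂ) * ‖θ.2‖ ^ 2 +
        2 * Real.pi * ((inner ℝ (y - x) θ.2 : ℝ) : ℂ)) := by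
    intro θ
    rw [windowDensity, smul_eq_mul, Complex.ofReal_exp, mul_comm (Complex.exp (_ * Complex.I)),
      mul_assoc (𝓕 (gaussianWindow f x) θ.1), mul_assoc (𝓕 (gaussianWindow f x) θ.1),
      ← Complex.exp_add, ← Complex.exp_add]
    congr 2
    rw [expPhase, inner_sub_left, real_inner_comm y θ.2]
    push_cast
    ring
  simp_rw [h3]
  rw [integral_prod_mul (fun ξ => Complex.exp (((2 * Real.pi * inner ℝ ξ y : ℝ) : ℂ) *
    Complex.I) • 𝓕 (gaussianWindow f x) ξ) (fun s => Complex.exp (-(Real.pi : ℂ) * ‖s‖ ^ 2 +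
        2 * Real.pi * ((inner ℝ (y - x) s : ℝ) : ℂ))), h1, h2, gaussianWindow, Complex.ofReal_exp,
    mul_right_comm, ← Complex.exp_add, norm_sub_rev]
  have h4 : (((-(Real.pi * ‖y - x‖ ^ 2) : ℝ) : ℂ) +
      (2 * (Real.pi : ℂ)) ^ 2 * (‖y - x‖ : ℂ) ^ 2 / (4 * Real.pi)) = 0 := by
    push_cast
    field_simp
    ring
  rw [h4, Complex.exp_zero, one_mul]

/-- Decay in `x` together with the growth in `α`, from the decay of `f` and of `𝓕 f` alone. -/
lemma exists_youngFactor_mul_norm_multiDeriv_le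
    (hω : ∀ j, IsWeightFunction (ω j)) (hσ : ∀ j, IsWeightFunction (σ j))
    (f : 𝓢(EuclideanSpace ℝ (Fin N), ℂ)) (hf : RapidDecay ω f)
    (hf' : RapidDecay σ (𝓕 (f : EuclideanSpace ℝ (Fin N) → ℂ))) {r t : ℝ} (hr : 0 < r)
    (ht : 0 < t) :
    ∃ C : ℝ, 0 < C ∧ ∀ (α : Fin N → ℕ) (x : EuclideanSpace ℝ (Fin N)),
      youngFactor σ r α * ‖multiDeriv α f x‖ ≤ C * Real.exp (-(t * sumWeight ω x)) := by
  obtain ⟨K, hK, hKx⟩ := sumWeight_le_of_abs_le_add hσ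
  obtain ⟨L, hL, hLx⟩ := sumWeight_smul_le hσ (2 * Real.pi)
  obtain ⟨B, c, hB, hc, hBc⟩ := polyWeight_le_exp_sumWeight hσ
  obtain ⟨Y, hY, hYx⟩ := youngFactor_mul_prod_le hσ hr
  -- r * (K * L) cancels the growth of the Young bound in θ.1; c leaves an integrable inverse
  -- weight.
  obtain ⟨C, hC, hCx⟩ := exists_norm_fourier_gaussianWindow_le hω hσ f hf hf'
    (r := t) (s := r * (K * L) + c) ht (by positivity)
  have hgint := integrable_exp_sumWeight_mul_gaussian hσ (r := r * (K * L)) (by positivity)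
  set D := C * B * Y * Real.exp (r * K * (1 + 2 * L)) with hD
  set g : EuclideanSpace ℝ (Fin N) × EuclideanSpace ℝ (Fin N) → ℝ := fun θ =>
    (polyWeight θ.1)⁻¹ * (Real.exp (r * (K * L) * sumWeight σ θ.2) *
      Real.exp (-(Real.pi * ‖θ.2‖ ^ 2))) with hg
  have hgi : Integrable g (volume.prod volume) := integrable_inv_polyWeight.mul_prod hgint
  have hg0 : 0 ≤ ∫ θ, g θ ∂(volume.prod volume) := integral_nonneg fun θ => by
    have := polyWeight_pos θ.1
    positivity
  refine ⟨D * (1 + ∫ θ, g θ ∂(volume.prod volume)), by positivity, fun α x => ?_⟩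
  obtain ⟨hE, hVi⟩ := expIntegrable_windowDensity hω hσ f hf hf' x
  -- The window centre x stays fixed during differentiation in y; only afterwards is y = x, so the
  -- window is never differentiated.
  have hrep := (hE.iteratedLineDerivOp_eq (multiDir α) f (eq_integral_windowDensity f x hVi)).2 x
  rw [norm_multiDeriv, hrep, ← Real.norm_of_nonneg (youngFactor_nonneg σ r α), ← norm_smul,
    ← integral_smul]
  have hbound : ∀ θ, ‖youngFactor σ r α • (((∏ i, expPhase θ (multiDir α i)) *
      windowDensity f x θ) * Complex.exp (expPhase θ x))‖ ≤
      D * Real.exp (-(t * sumWeight ω x)) * g θ := by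
    intro θ
    -- The coordinates of u bound the linear forms produced by each derivative, so the Young bound
    -- applies at u.
    set u : EuclideanSpace ℝ (Fin N) := WithLp.toLp 2 fun j =>
      2 * Real.pi * (|θ.1 j| + |θ.2 j|) with hu
    have hu0 : ∀ j, u j = |((2 * Real.pi) • θ.1) j| + |((2 * Real.pi) • θ.2) j| := fun j => by
      simp [hu, abs_mul, abs_of_pos Real.pi_pos, mul_add, mul_assoc]
    have hprod : ‖∏ i, expPhase θ (multiDir α i)‖ ≤ ∏ j, |u j| ^ α j := by
      rw [norm_prod, ← prod_multiDir α fun j => |u j|]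
      refine Finset.prod_le_prod (fun i _ => norm_nonneg _) fun i _ => ?_
      refine (norm_expPhase_le _ _).trans (le_trans (le_of_eq ?_) (le_abs_self _))
      simp [multiDir, EuclideanSpace.inner_single_right, hu]
    have hsum : sumWeight σ u ≤ K * (1 + 2 * L) + K * L * sumWeight σ θ.1 +
        K * L * sumWeight σ θ.2 := by
      refine (hKx u ((2 * Real.pi) • θ.1) ((2 * Real.pi) • θ.2) fun j => ?_).trans ?_
      · rw [abs_of_nonneg (by rw [hu0]; positivity), hu0]
      · have h1 := hLx θ.1
        have h2 := hLx θ.2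
        calc _ ≤ K * (1 + L * (1 + sumWeight σ θ.1) + L * (1 + sumWeight σ θ.2)) := by gcongr
          _ = _ := by ring
    -- At y = x the real exponentials in ⟨x, θ.2⟩ cancel, which makes the bound uniform in x.
    have hnorm : ‖windowDensity f x θ * Complex.exp (expPhase θ x)‖ =
        ‖𝓕 (gaussianWindow f x) θ.1‖ * Real.exp (-(Real.pi * ‖θ.2‖ ^ 2)) := by
      rw [windowDensity, norm_mul, norm_mul, Complex.norm_real,
        Real.norm_of_nonneg (Real.exp_pos _).le, Complex.norm_exp, re_expPhase, mul_assoc,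
        ← Real.exp_add, real_inner_comm x θ.2]
      congr 2
      ring
    rw [norm_smul, Real.norm_of_nonneg (youngFactor_nonneg σ r α), mul_assoc, norm_mul, hnorm,
      ← mul_assoc]
    have h1 : youngFactor σ r α * ‖∏ i, expPhase θ (multiDir α i)‖ ≤
        Y * Real.exp (r * (K * (1 + 2 * L) + K * L * sumWeight σ θ.1 +
          K * L * sumWeight σ θ.2)) := by
      calc _ ≤ youngFactor σ r α * ∏ j, |u j| ^ α j := by
            have := youngFactor_nonneg σ r α
            gcongr
        _ ≤ Y * Real.exp (r * sumWeight σ u) := hYx α u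
        _ ≤ _ := by gcongr
    have hw := polyWeight_pos θ.1
    have h2 : Real.exp (-(c * sumWeight σ θ.1)) ≤ B * (polyWeight θ.1)⁻¹ := by
      rw [Real.exp_neg, ← div_eq_mul_inv, inv_eq_one_div,
        div_le_div_iff₀ (Real.exp_pos _) hw, one_mul]
      exact hBc θ.1
    calc _ ≤ (Y * Real.exp (r * (K * (1 + 2 * L) + K * L * sumWeight σ θ.1 +
          K * L * sumWeight σ θ.2))) * ((C * Real.exp (-(t * sumWeight ω x)) *
            Real.exp (-((r * (K * L) + c) * sumWeight σ θ.1))) *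
              Real.exp (-(Real.pi * ‖θ.2‖ ^ 2))) := by
          gcongr
          exact hCx x θ.1
      _ = (C * Y * Real.exp (r * K * (1 + 2 * L)) * Real.exp (-(t * sumWeight ω x))) *
          (Real.exp (-(c * sumWeight σ θ.1)) * (Real.exp (r * (K * L) * sumWeight σ θ.2) *
            Real.exp (-(Real.pi * ‖θ.2‖ ^ 2)))) := by
          have : Real.exp (r * (K * (1 + 2 * L) + K * L * sumWeight σ θ.1 +
              K * L * sumWeight σ θ.2)) * Real.exp (-((r * (K * L) + c) * sumWeight σ θ.1)) =
              Real.exp (r * K * (1 + 2 * L)) * (Real.exp (-(c * sumWeight σ θ.1)) *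
                Real.exp (r * (K * L) * sumWeight σ θ.2)) := by
            simp only [← Real.exp_add]
            congr 1
            ring
          linear_combination (Y * C * Real.exp (-(t * sumWeight ω x)) *
            Real.exp (-(Real.pi * ‖θ.2‖ ^ 2))) * this
      _ ≤ (C * Y * Real.exp (r * K * (1 + 2 * L)) * Real.exp (-(t * sumWeight ω x))) *
          (B * (polyWeight θ.1)⁻¹ * (Real.exp (r * (K * L) * sumWeight σ θ.2) *
            Real.exp (-(Real.pi * ‖θ.2‖ ^ 2)))) := by gcongr
      _ = _ := by rw [hD, hg]; ring
  refine (norm_integral_le_of_norm_le (hgi.const_mul _) (Eventually.of_forall hbound)).trans ?_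
  rw [integral_const_mul]
  have hD0 : 0 ≤ D := by positivity
  calc _ = D * (∫ θ, g θ ∂(volume.prod volume)) * Real.exp (-(t * sumWeight ω x)) := by ring
    _ ≤ _ := by gcongr; linarith

end MixedEstimate

/-! ### The two normalisations of the Fourier transform. -/

section FourierHat

open FourierTransform LineDeriv

variable {N : ℕ} {ω σ : Fin N → ℝ → ℝ}

lemma fourierHat_eq (f : EuclideanSpace ℝ (Fin N) → ℂ) (ξ : EuclideanSpace ℝ (Fin N)) :
    fourierHat f ξ = 𝓕 f ((2 * Real.pi)⁻¹ • ξ) := by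
  rw [fourierHat, Real.fourier_eq']
  refine integral_congr_ae (Eventually.of_forall fun x => ?_)
  have : -2 * Real.pi * inner ℝ x ((2 * Real.pi)⁻¹ • ξ) = -inner ℝ x ξ := by
    rw [inner_smul_right]
    have := Real.pi_ne_zero
    field_simp
  simp only [this, smul_eq_mul]
  congr 2
  push_cast
  ring

lemma exists_schwartzMap_eq_fourierHat (f : 𝓢(EuclideanSpace ℝ (Fin N), ℂ)) :
    ∃ g : 𝓢(EuclideanSpace ℝ (Fin N), ℂ), ⇑g = fourierHat f := by
  have h : (2 * Real.pi)⁻¹ ≠ 0 := by positivity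
  refine ⟨SchwartzMap.compCLMOfContinuousLinearEquiv ℂ
    (LinearEquiv.smulOfNeZero ℝ (EuclideanSpace ℝ (Fin N)) _ h).toContinuousLinearEquiv (𝓕 f), ?_⟩
  ext ξ
  rw [fourierHat_eq, ← SchwartzMap.fourier_coe]
  rfl

/-- The dilation factor 2π exceeds 1, so monotonicity of the weight suffices. -/
lemma RapidDecay.fourier_of_fourierHat (hσ : ∀ j, IsWeightFunction (σ j))
    {f : EuclideanSpace ℝ (Fin N) → ℂ} (h : RapidDecay σ (fourierHat f)) :
    RapidDecay σ (𝓕 f) := by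
  intro r hr
  obtain ⟨C, hC, hCx⟩ := h r hr
  refine ⟨C, hC, fun ξ => ?_⟩
  have h1 := hCx ((2 * Real.pi) • ξ)
  rw [fourierHat_eq, smul_smul, inv_mul_cancel₀ (by positivity), one_smul] at h1
  refine h1.trans ?_
  gcongr
  refine sumWeight_le_of_abs_le hσ fun j => ?_
  rw [PiLp.smul_apply, smul_eq_mul, abs_mul]
  refine le_mul_of_one_le_left (abs_nonneg _) (le_trans ?_ (le_abs_self _))
  linarith [Real.pi_gt_three]

lemma norm_fourier_iteratedLineDerivOp {n : ℕ} (m : Fin n → EuclideanSpace ℝ (Fin N))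
    (f : 𝓢(EuclideanSpace ℝ (Fin N), ℂ)) (ξ : EuclideanSpace ℝ (Fin N)) :
    ‖(𝓕 (∂^{m} f : 𝓢(EuclideanSpace ℝ (Fin N), ℂ))) ξ‖ =
      (∏ i, (2 * Real.pi * |inner ℝ ξ (m i)|)) * ‖(𝓕 f) ξ‖ := by
  induction n with
  | zero => simp
  | succ n ih =>
    have hg : (fun x : EuclideanSpace ℝ (Fin N) => inner ℝ x (m 0)).HasTemperateGrowth := by
      fun_prop
    rw [iteratedLineDerivOp_succ_left, SchwartzMap.fourier_lineDerivOp_eq, smul_apply,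
      SchwartzMap.smulLeftCLM_apply_apply hg, norm_smul, norm_smul, ih, Fin.prod_univ_succ]
    simp [abs_of_pos Real.pi_pos, Fin.tail]
    ring

lemma prod_abs_pow_mul_norm_fourierHat_le (α : Fin N → ℕ)
    (f : 𝓢(EuclideanSpace ℝ (Fin N), ℂ)) (ξ : EuclideanSpace ℝ (Fin N)) :
    ENNReal.ofReal ((∏ j, |ξ j| ^ α j) * ‖fourierHat f ξ‖) ≤
      eLpNorm (multiDeriv α f) 1 volume := by
  have h1 := norm_fourier_iteratedLineDerivOp (multiDir α) f ((2 * Real.pi)⁻¹ • ξ)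
  have h2 : (∏ i, (2 * Real.pi * |inner ℝ ((2 * Real.pi)⁻¹ • ξ) (multiDir α i)|)) =
      ∏ j, |ξ j| ^ α j := by
    rw [← prod_multiDir α fun j => |ξ j|]
    refine Finset.prod_congr rfl fun i _ => ?_
    have := Real.pi_pos
    simp [multiDir, EuclideanSpace.inner_single_right, abs_mul, abs_of_pos Real.pi_pos]
    field_simp
  have h3 : ‖𝓕 (⇑(∂^{multiDir α} f : 𝓢(EuclideanSpace ℝ (Fin N), ℂ))) ((2 * Real.pi)⁻¹ • ξ)‖ ≤
      ∫ x, ‖(∂^{multiDir α} f : 𝓢(EuclideanSpace ℝ (Fin N), ℂ)) x‖ :=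
    VectorFourier.norm_fourierIntegral_le_integral_norm _ _ _ _ _
  rw [h2, SchwartzMap.fourier_coe, SchwartzMap.fourier_coe] at h1
  rw [fourierHat_eq, ← h1]
  refine (ENNReal.ofReal_le_ofReal h3).trans (le_of_eq ?_)
  rw [ofReal_integral_norm_eq_lintegral_enorm (SchwartzMap.integrable _),
    eLpNorm_one_eq_lintegral_enorm]
  refine lintegral_congr fun x => ?_
  rw [← ofReal_norm, ← ofReal_norm, norm_multiDeriv]

end FourierHat

/-! ### From rapid decay to the conditions and back. -/

section Conditions

variable {N : ℕ} {ω σ : Fin N → ℝ → ℝ}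

lemma RapidDecay.mixed_bound (hω : ∀ j, IsWeightFunction (ω j))
    (hσ : ∀ j, IsWeightFunction (σ j)) {f : 𝓢(EuclideanSpace ℝ (Fin N), ℂ)}
    (hf : RapidDecay ω f) (hf' : RapidDecay σ (fourierHat f)) {p : ℝ≥0∞} (hp : 1 ≤ p) {r s : ℝ}
    (hr : 0 < r) (hs : 0 < s) :
    ∃ C : ℝ, 0 < C ∧ ∀ α β : Fin N → ℕ,
      eLpNorm (fun x => ((youngFactor σ r α * youngFactor ω s β : ℝ) : ℂ) *
        (monomialFun β x : ℂ) * multiDeriv α f x) p volume ≤ ENNReal.ofReal C := by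
  obtain ⟨A, c, hA, hc, h⟩ := exists_eLpNorm_exp_sumWeight_mul_le hω hp
  obtain ⟨B, hB, hBx⟩ := youngFactor_mul_prod_le hω hs
  obtain ⟨C, hC, hCx⟩ := exists_youngFactor_mul_norm_multiDeriv_le hω hσ f hf
    (hf'.fourier_of_fourierHat hσ) hr (t := s + c) (by positivity)
  refine ⟨B * C * A, by positivity, fun α β => h _ (B * C) (by positivity) fun x => ?_⟩
  have h1 : ‖((youngFactor σ r α * youngFactor ω s β : ℝ) : ℂ) *
      (monomialFun β x : ℂ) * multiDeriv α f x‖ =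
      (youngFactor ω s β * ∏ j, |x j| ^ β j) * (youngFactor σ r α * ‖multiDeriv α f x‖) := by
    rw [norm_mul, norm_mul, Complex.norm_real, Complex.norm_real, Real.norm_of_nonneg
      (mul_nonneg (youngFactor_nonneg _ _ _) (youngFactor_nonneg _ _ _)), monomialFun,
      Real.norm_eq_abs, Finset.abs_prod]
    simp_rw [abs_pow]
    ring
  rw [h1]
  have h2 := youngFactor_nonneg σ r α
  calc _ ≤ (B * Real.exp (s * sumWeight ω x)) * (C * Real.exp (-((s + c) * sumWeight ω x))) :=
        mul_le_mul (hBx β x) (hCx α x) (by positivity) (by positivity)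
    _ = B * C * Real.exp (-(c * sumWeight ω x)) := by
        rw [mul_mul_mul_comm, ← Real.exp_add]; congr 2; ring

/-- Expanding ∏ (1 + x_j²) over subsets shows that finitely many monomials suffice to pass from L^p
to L^1. -/
lemma exists_eLpNorm_one_le_sum_monomialFun {p : ℝ≥0∞} (hp : 1 ≤ p) :
    ∃ A : ℝ, 0 < A ∧ ∀ G : EuclideanSpace ℝ (Fin N) → ℂ, Continuous G →
      eLpNorm G 1 volume ≤ ENNReal.ofReal A * ∑ S : Finset (Fin N),
        eLpNorm (fun x => (monomialFun (fun j => if j ∈ S then 2 else 0) x : ℂ) * G x) p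
          volume := by
  obtain ⟨A, hA, h⟩ := exists_eLpNorm_one_inv_polyWeight_mul_le (N := N) hp
  refine ⟨A, hA, fun G hG => ?_⟩
  have hc := continuous_polyWeight (N := N)
  have h1 := h (fun x => (polyWeight x : ℂ) * G x)
    (Continuous.aestronglyMeasurable (by fun_prop))
  have h2 : (fun x => (((polyWeight x)⁻¹ : ℝ) : ℂ) * ((polyWeight x : ℂ) * G x)) = G := by
    ext x
    rw [← mul_assoc, ← Complex.ofReal_mul, inv_mul_cancel₀ (polyWeight_pos x).ne',
      Complex.ofReal_one, one_mul]
  rw [h2] at h1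
  refine h1.trans ?_
  gcongr
  have h3 : (fun x => (polyWeight x : ℂ) * G x) = ∑ S : Finset (Fin N), fun x =>
      (monomialFun (fun j => if j ∈ S then 2 else 0) x : ℂ) * G x := by
    ext x
    rw [Finset.sum_apply, ← Finset.sum_mul, polyWeight, Finset.prod_one_add,
      Finset.powerset_univ]
    push_cast
    congr 1
    refine Finset.sum_congr rfl fun S _ => ?_
    simp [monomialFun, pow_ite]
  rw [h3]
  refine eLpNorm_sum_le (fun S _ => Continuous.aestronglyMeasurable ?_) hp
  unfold monomialFun
  fun_prop

lemma rapidDecay_fourierHat_of_bound (hσ : ∀ j, IsWeightFunction (σ j))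
    (f : 𝓢(EuclideanSpace ℝ (Fin N), ℂ)) {p : ℝ≥0∞} (hp : 1 ≤ p)
    (h : ∀ r : ℝ, 0 < r → ∀ β : Fin N → ℕ, ∃ C : ℝ, 0 < C ∧ ∀ α : Fin N → ℕ,
      eLpNorm (fun x => (youngFactor σ r α : ℂ) * (monomialFun β x : ℂ) * multiDeriv α f x) p
        volume ≤ ENNReal.ofReal C) :
    RapidDecay σ (fourierHat f) := by
  intro r hr
  obtain ⟨μ, C, hμ, hC, hCx⟩ := exp_sumWeight_le_youngFactor hσ hr
  obtain ⟨A, hA, hAG⟩ := exists_eLpNorm_one_le_sum_monomialFun (N := N) hp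
  choose D hD hDx using fun S : Finset (Fin N) => h μ hμ fun j => if j ∈ S then 2 else 0
  have hkey : ∀ (α : Fin N → ℕ) (ξ : EuclideanSpace ℝ (Fin N)),
      youngFactor σ μ α * ((∏ j, |ξ j| ^ α j) * ‖fourierHat f ξ‖) ≤ A * ∑ S, D S := by
    intro α ξ
    have h0 : 0 ≤ ∑ S, D S := Finset.sum_nonneg fun S _ => (hD S).le
    rw [← ENNReal.ofReal_le_ofReal_iff (by positivity),
      ENNReal.ofReal_mul (youngFactor_nonneg _ _ _), ENNReal.ofReal_mul hA.le,
      ENNReal.ofReal_sum_of_nonneg fun S _ => (hD S).le]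
    have h1 := hAG (fun x => (youngFactor σ μ α : ℂ) * multiDeriv α f x)
      (continuous_const.mul (continuous_multiDeriv α f))
    calc _ ≤ ENNReal.ofReal (youngFactor σ μ α) * eLpNorm (multiDeriv α f) 1 volume := by
          gcongr
          exact prod_abs_pow_mul_norm_fourierHat_le α f ξ
      _ = eLpNorm (fun x => (youngFactor σ μ α : ℂ) * multiDeriv α f x) 1 volume := by
          have h2 := eLpNorm_const_smul (youngFactor σ μ α : ℂ) (multiDeriv α f) 1
            (volume : Measure (EuclideanSpace ℝ (Fin N)))
          rw [← ofReal_norm, Complex.norm_real,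
            Real.norm_of_nonneg (youngFactor_nonneg _ _ _)] at h2
          exact h2.symm
      _ ≤ _ := h1
      _ ≤ _ := by
          gcongr with S
          refine le_trans (le_of_eq ?_) (hDx S α)
          congr 1
          ext x
          ring
  have h0 : 0 ≤ ∑ S, D S := Finset.sum_nonneg fun S _ => (hD S).le
  refine ⟨C * (A * ∑ S, D S + 1), by positivity, fun ξ => ?_⟩
  obtain ⟨β, hβ⟩ := hCx ξ
  rw [Real.exp_neg, ← div_eq_mul_inv, le_div_iff₀ (Real.exp_pos _), mul_comm]
  -- The bound on the transform is pointwise, so the gain e^{-|β|} can be discarded here.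
  have h1 : ∏ j, Real.exp (-(β j : ℝ)) ≤ 1 :=
    Finset.prod_le_one (fun j _ => (Real.exp_pos _).le) fun j _ => by simp
  have h2 := youngFactor_nonneg σ μ β
  calc _ ≤ C * ((∏ j, Real.exp (-(β j : ℝ))) * ((∏ j, |ξ j| ^ β j) * youngFactor σ μ β)) *
        ‖fourierHat f ξ‖ := by gcongr
    _ ≤ C * (1 * ((∏ j, |ξ j| ^ β j) * youngFactor σ μ β)) * ‖fourierHat f ξ‖ := by gcongr
    _ = C * (youngFactor σ μ β * ((∏ j, |ξ j| ^ β j) * ‖fourierHat f ξ‖)) := by ring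
    _ ≤ _ := by
        gcongr
        exact (hkey β ξ).trans (by linarith)

lemma tsum_pi_prod (g : ℕ → ℝ≥0∞) :
    ∀ n : ℕ, ∑' β : Fin n → ℕ, ∏ j, g (β j) = (∑' k, g k) ^ n
  | 0 => by simp
  | n + 1 => by
    rw [← (Fin.consEquiv fun _ : Fin (n + 1) => ℕ).tsum_eq]
    simp only [Fin.consEquiv, Equiv.coe_fn_mk, Fin.prod_univ_succ, Fin.cons_zero, Fin.cons_succ]
    rw [ENNReal.tsum_prod (f := fun k (β : Fin n → ℕ) => g k * ∏ j, g (β j))]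
    simp only [ENNReal.tsum_mul_left, tsum_pi_prod g n, ENNReal.tsum_mul_right, pow_succ']

lemma tsum_ofReal_exp_neg_ne_top :
    ∑' β : Fin N → ℕ, ENNReal.ofReal (∏ j, Real.exp (-(β j : ℝ))) ≠ ∞ := by
  have h1 : ∀ β : Fin N → ℕ, ENNReal.ofReal (∏ j, Real.exp (-(β j : ℝ))) =
      ∏ j, ENNReal.ofReal (Real.exp (-(β j : ℝ))) := fun β =>
    ENNReal.ofReal_prod_of_nonneg fun j _ => (Real.exp_pos _).le
  simp_rw [h1]
  rw [tsum_pi_prod (fun k => ENNReal.ofReal (Real.exp (-(k : ℝ))))]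
  exact ENNReal.pow_ne_top Real.summable_exp_neg_nat.tsum_ofReal_ne_top

/-- The good β depends on x while the bounds are only in L^q. Summing over all β removes the
dependence, and the factors e^{-|β|} make the sum finite. -/
lemma rapidDecay_of_bound (hω : ∀ j, IsWeightFunction (ω j))
    (f : 𝓢(EuclideanSpace ℝ (Fin N), ℂ)) {q : ℝ≥0∞} (hq : 1 ≤ q)
    (h : ∀ s : ℝ, 0 < s → ∃ C : ℝ, 0 < C ∧ ∀ β : Fin N → ℕ,
      eLpNorm (fun x => (youngFactor ω s β : ℂ) * (monomialFun β x : ℂ) * f x) q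
        volume ≤ ENNReal.ofReal C) :
    RapidDecay ω f := by
  refine rapidDecay_of_integrable hω f fun r hr => ?_
  obtain ⟨B, c, hB, hc, hBc⟩ := polyWeight_le_exp_sumWeight hω
  obtain ⟨μ, C, hμ, hC, hCx⟩ := exp_sumWeight_le_youngFactor hω (r := r + c) (by positivity)
  obtain ⟨D, hD, hDx⟩ := h μ hμ
  obtain ⟨A, hA, hH⟩ := exists_eLpNorm_one_inv_polyWeight_mul_le (N := N) hq
  have hcont := continuous_sumWeight hω
  have hfc := f.continuous
  set G : (Fin N → ℕ) → EuclideanSpace ℝ (Fin N) → ℂ := fun β x =>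
    (((polyWeight x)⁻¹ : ℝ) : ℂ) *
      ((youngFactor ω μ β : ℂ) * (monomialFun β x : ℂ) * f x) with hG
  have hGc : ∀ β, Continuous (G β) := fun β => by
    have h1 : Continuous fun x => (youngFactor ω μ β : ℂ) * (monomialFun β x : ℂ) * f x := by
      unfold monomialFun; fun_prop
    exact (Complex.continuous_ofReal.comp continuous_inv_polyWeight).mul h1
  have hGi : ∀ β, ∫⁻ x, ‖G β x‖ₑ ≤ ENNReal.ofReal A * ENNReal.ofReal D := fun β => by
    rw [← eLpNorm_one_eq_lintegral_enorm]
    refine (hH _ (Continuous.aestronglyMeasurable ?_)).trans (by gcongr; exact hDx β)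
    unfold monomialFun; fun_prop
  set e : (Fin N → ℕ) → ℝ := fun β => ∏ j, Real.exp (-(β j : ℝ)) with he
  have he0 : ∀ β, 0 < e β := fun β => Finset.prod_pos fun j _ => Real.exp_pos _
  have hpt : ∀ x, ‖Real.exp (r * sumWeight ω x) * ‖f x‖‖ₑ ≤
      ∑' β, ENNReal.ofReal (B * C) * (ENNReal.ofReal (e β) * ‖G β x‖ₑ) := by
    intro x
    obtain ⟨β, hβ⟩ := hCx x
    refine le_trans ?_ (ENNReal.le_tsum β)
    rw [← ofReal_norm, ← ofReal_norm, ← ENNReal.ofReal_mul (he0 β).le,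
      ← ENNReal.ofReal_mul (by positivity)]
    apply ENNReal.ofReal_le_ofReal
    have hw := polyWeight_pos x
    have h1 : ‖G β x‖ = (polyWeight x)⁻¹ * ((∏ j, |x j| ^ β j) * youngFactor ω μ β * ‖f x‖) := by
      rw [hG]
      simp only [norm_mul, Complex.norm_real, Real.norm_of_nonneg (inv_pos.2 hw).le,
        Real.norm_of_nonneg (youngFactor_nonneg ω μ β), monomialFun, Real.norm_eq_abs,
        Finset.abs_prod, abs_pow]
      ring
    have h2 : 1 ≤ B * Real.exp (c * sumWeight ω x) * (polyWeight x)⁻¹ := by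
      rw [← div_eq_mul_inv, le_div_iff₀ hw, one_mul]
      exact hBc x
    rw [Real.norm_of_nonneg (by positivity), h1]
    calc Real.exp (r * sumWeight ω x) * ‖f x‖
        ≤ (B * Real.exp (c * sumWeight ω x) * (polyWeight x)⁻¹) *
          (Real.exp (r * sumWeight ω x) * ‖f x‖) := le_mul_of_one_le_left (by positivity) h2
      _ = B * (polyWeight x)⁻¹ * ‖f x‖ * Real.exp ((r + c) * sumWeight ω x) := by
          rw [add_mul, Real.exp_add]; ring
      _ ≤ B * (polyWeight x)⁻¹ * ‖f x‖ *
          (C * (e β * ((∏ j, |x j| ^ β j) * youngFactor ω μ β))) := by gcongr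
      _ = _ := by ring
  refine ⟨by fun_prop, ?_⟩
  refine (lintegral_mono hpt).trans_lt ?_
  rw [lintegral_tsum fun β => ((hGc β).enorm.measurable.const_mul _).const_mul _ |>.aemeasurable]
  refine (ENNReal.tsum_le_tsum (g := fun β => ENNReal.ofReal (B * C) *
    (ENNReal.ofReal (e β) * (ENNReal.ofReal A * ENNReal.ofReal D))) fun β => ?_).trans_lt ?_
  · rw [lintegral_const_mul _ ((hGc β).enorm.measurable.const_mul _),
      lintegral_const_mul _ (hGc β).enorm.measurable]
    gcongr
    exact hGi β
  · rw [ENNReal.tsum_mul_left, ENNReal.tsum_mul_right]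
    exact ENNReal.mul_lt_top ENNReal.ofReal_lt_top (ENNReal.mul_lt_top
      tsum_ofReal_exp_neg_ne_top.lt_top
      (ENNReal.mul_lt_top ENNReal.ofReal_lt_top ENNReal.ofReal_lt_top))

/-- Dividing a uniform bound by a fixed nonzero factor. -/
lemma eLpNorm_le_of_ofReal_mul {p : ℝ≥0∞} {F : EuclideanSpace ℝ (Fin N) → ℂ} {a C : ℝ}
    (ha : 0 < a) (h : eLpNorm (fun x => (a : ℂ) * F x) p volume ≤ ENNReal.ofReal C) :
    eLpNorm F p volume ≤ ENNReal.ofReal (a⁻¹ * C) := by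
  have h1 : F = ((a⁻¹ : ℝ) : ℂ) • fun x => (a : ℂ) * F x := by
    ext x
    rw [Pi.smul_apply, smul_eq_mul, ← mul_assoc, ← Complex.ofReal_mul, inv_mul_cancel₀ ha.ne',
      Complex.ofReal_one, one_mul]
  rw [h1, eLpNorm_const_smul, ← ofReal_norm, Complex.norm_real,
    Real.norm_of_nonneg (inv_pos.2 ha).le, ENNReal.ofReal_mul (inv_pos.2 ha).le]
  gcongr

/-- β is fixed, so s may be chosen with a positive factor, which is then divided out. -/
lemma bound_deriv_of_mixed_bound (hω : ∀ j, IsWeightFunction (ω j))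
    (f : EuclideanSpace ℝ (Fin N) → ℂ) {p : ℝ≥0∞} {r : ℝ}
    (h : ∀ s : ℝ, 0 < s → ∃ C : ℝ, 0 < C ∧ ∀ α β : Fin N → ℕ,
      eLpNorm (fun x => ((youngFactor σ r α * youngFactor ω s β : ℝ) : ℂ) *
        (monomialFun β x : ℂ) * multiDeriv α f x) p volume ≤ ENNReal.ofReal C)
    (β : Fin N → ℕ) :
    ∃ C : ℝ, 0 < C ∧ ∀ α : Fin N → ℕ,
      eLpNorm (fun x => (youngFactor σ r α : ℂ) * (monomialFun β x : ℂ) * multiDeriv α f x) p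
        volume ≤ ENNReal.ofReal C := by
  obtain ⟨s, hs, hpos⟩ := exists_youngFactor_pos hω β
  obtain ⟨C, hC, hCx⟩ := h s hs
  refine ⟨(youngFactor ω s β)⁻¹ * C, by positivity, fun α =>
    eLpNorm_le_of_ofReal_mul hpos (le_trans (le_of_eq ?_) (hCx α β))⟩
  congr 1
  ext x
  push_cast
  ring

lemma bound_mul_of_mixed_bound (hσ : ∀ j, IsWeightFunction (σ j))
    (f : EuclideanSpace ℝ (Fin N) → ℂ) {p : ℝ≥0∞} {s : ℝ}
    (h : ∀ r : ℝ, 0 < r → ∃ C : ℝ, 0 < C ∧ ∀ α β : Fin N → ℕ,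
      eLpNorm (fun x => ((youngFactor σ r α * youngFactor ω s β : ℝ) : ℂ) *
        (monomialFun β x : ℂ) * multiDeriv α f x) p volume ≤ ENNReal.ofReal C)
    (α : Fin N → ℕ) :
    ∃ C : ℝ, 0 < C ∧ ∀ β : Fin N → ℕ,
      eLpNorm (fun x => (youngFactor ω s β : ℂ) * (monomialFun β x : ℂ) * multiDeriv α f x) p
        volume ≤ ENNReal.ofReal C := by
  obtain ⟨r, hr, hpos⟩ := exists_youngFactor_pos hσ α
  obtain ⟨C, hC, hCx⟩ := h r hr
  refine ⟨(youngFactor σ r α)⁻¹ * C, by positivity, fun β =>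
    eLpNorm_le_of_ofReal_mul hpos (le_trans (le_of_eq ?_) (hCx α β))⟩
  congr 1
  ext x
  push_cast
  ring

lemma mem_ultraSpace_of_rapidDecay (hω : ∀ j, IsWeightFunction (ω j))
    (hσ : ∀ j, IsWeightFunction (σ j)) {f : 𝓢(EuclideanSpace ℝ (Fin N), ℂ)}
    (hf : RapidDecay ω f) (hf' : RapidDecay σ (fourierHat f)) :
    (f : EuclideanSpace ℝ (Fin N) → ℂ) ∈ ultraSpace ω σ := by
  obtain ⟨g, hg⟩ := exists_schwartzMap_eq_fourierHat f
  rw [← hg] at hf'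
  refine ⟨f.integrable, f.smooth _, hg ▸ g.smooth _, fun r hr α => ?_, fun r hr α => ?_⟩
  · exact (hf.multiDeriv_schwartzMap hω α).eLpNorm_exp_mul_lt_top hω le_top hr
  · rw [← hg]
    exact (hf'.multiDeriv_schwartzMap hσ α).eLpNorm_exp_mul_lt_top hσ le_top hr

end Conditions

theorem mainTheorem6 {N : ℕ} (ω σ : Fin N → ℝ → ℝ)
    (hω : ∀ j, IsWeightFunction (ω j)) (hσ : ∀ j, IsWeightFunction (σ j))
    (f : 𝓢(EuclideanSpace ℝ (Fin N), ℂ)) (p q : ℝ≥0∞) (hp : 1 ≤ p) (hq : 1 ≤ q) :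
    List.TFAE [
      -- (1)
      (f : EuclideanSpace ℝ (Fin N) → ℂ) ∈ ultraSpace ω σ,
      -- (2)
      (∀ r : ℝ, 0 < r → ∀ α : Fin N → ℕ,
          eLpNorm (fun x => (Real.exp (r * sumWeight ω x) : ℂ) * multiDeriv α f x)
            p volume < ∞) ∧
        (∀ r : ℝ, 0 < r → ∀ α : Fin N → ℕ,
          eLpNorm (fun ξ => (Real.exp (r * sumWeight σ ξ) : ℂ) * multiDeriv α (fourierHat f) ξ)
            q volume < ∞),
      -- (3)
      (∀ r : ℝ, 0 < r →
          eLpNorm (fun x => (Real.exp (r * sumWeight ω x) : ℂ) * f x) p volume < ∞) ∧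
        (∀ r : ℝ, 0 < r →
          eLpNorm (fun ξ => (Real.exp (r * sumWeight σ ξ) : ℂ) * fourierHat f ξ)
            q volume < ∞),
      -- (4)
      (∀ r : ℝ, 0 < r → ∀ α : Fin N → ℕ,
          eLpNorm (fun x => (Real.exp (r * sumWeight ω x) : ℂ) * (monomialFun α x : ℂ) * f x)
            p volume < ∞) ∧
        (∀ r : ℝ, 0 < r → ∀ α : Fin N → ℕ,
          eLpNorm (fun ξ => (Real.exp (r * sumWeight σ ξ) : ℂ) * (monomialFun α ξ : ℂ) *
            fourierHat f ξ) q volume < ∞),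
      -- (5)
      (∀ r : ℝ, 0 < r → ∀ β : Fin N → ℕ, ∃ C : ℝ, 0 < C ∧ ∀ α : Fin N → ℕ,
          eLpNorm (fun x =>
            (expE (-((r : EReal) * sumYoungConj σ (fun j => (α j : ℝ) / r))) : ℂ) *
              (monomialFun β x : ℂ) * multiDeriv α f x) p volume ≤ ENNReal.ofReal C) ∧
        (∀ s : ℝ, 0 < s → ∀ α : Fin N → ℕ, ∃ C : ℝ, 0 < C ∧ ∀ β : Fin N → ℕ,
          eLpNorm (fun x =>
            (expE (-((s : EReal) * sumYoungConj ω (fun j => (β j : ℝ) / s))) : ℂ) *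
              (monomialFun β x : ℂ) * multiDeriv α f x) q volume ≤ ENNReal.ofReal C),
      -- (6)
      ∀ r s : ℝ, 0 < r → 0 < s → ∃ C : ℝ, 0 < C ∧ ∀ α β : Fin N → ℕ,
        eLpNorm (fun x =>
          (expE (-((r : EReal) * sumYoungConj σ (fun j => (α j : ℝ) / r)) -
              (s : EReal) * sumYoungConj ω (fun j => (β j : ℝ) / s)) : ℂ) *
            (monomialFun β x : ℂ) * multiDeriv α f x) p volume ≤ ENNReal.ofReal C
    ] := by
  have mono_zero : ∀ x : EuclideanSpace ℝ (Fin N), monomialFun 0 x = 1 := fun x => by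
    simp [monomialFun]
  obtain ⟨g, hg⟩ := exists_schwartzMap_eq_fourierHat f
  have decay : ∀ {p q : ℝ≥0∞}, 1 ≤ p → 1 ≤ q →
      (∀ r : ℝ, 0 < r →
        eLpNorm (fun x => (Real.exp (r * sumWeight ω x) : ℂ) * f x) p volume < ∞) →
      (∀ r : ℝ, 0 < r →
        eLpNorm (fun ξ => (Real.exp (r * sumWeight σ ξ) : ℂ) * fourierHat f ξ) q volume < ∞) →
      RapidDecay ω f ∧ RapidDecay σ (fourierHat f) := fun hp hq h1 h2 =>
    ⟨rapidDecay_of_eLpNorm_lt_top hω hp f h1,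
      hg ▸ rapidDecay_of_eLpNorm_lt_top hσ hq g (hg ▸ h2)⟩
  have mixed : RapidDecay ω f ∧ RapidDecay σ (fourierHat f) → ∀ {p : ℝ≥0∞}, 1 ≤ p →
      ∀ r s : ℝ, 0 < r → 0 < s → ∃ C : ℝ, 0 < C ∧ ∀ α β : Fin N → ℕ,
        eLpNorm (fun x => ((youngFactor σ r α * youngFactor ω s β : ℝ) : ℂ) *
          (monomialFun β x : ℂ) * multiDeriv α f x) p volume ≤ ENNReal.ofReal C :=
    fun h _ hp _ _ hr hs => h.1.mixed_bound hω hσ h.2 hp hr hs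
  have separate : ∀ {p q : ℝ≥0∞}, 1 ≤ p → 1 ≤ q →
      (∀ r : ℝ, 0 < r → ∀ β : Fin N → ℕ, ∃ C : ℝ, 0 < C ∧ ∀ α : Fin N → ℕ,
        eLpNorm (fun x => (youngFactor σ r α : ℂ) * (monomialFun β x : ℂ) * multiDeriv α f x)
          p volume ≤ ENNReal.ofReal C) →
      (∀ s : ℝ, 0 < s → ∀ α : Fin N → ℕ, ∃ C : ℝ, 0 < C ∧ ∀ β : Fin N → ℕ,
        eLpNorm (fun x => (youngFactor ω s β : ℂ) * (monomialFun β x : ℂ) * multiDeriv α f x)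
          q volume ≤ ENNReal.ofReal C) →
      RapidDecay ω f ∧ RapidDecay σ (fourierHat f) := fun hp hq ha hb =>
    ⟨rapidDecay_of_bound hω f hq fun s hs => by simpa only [multiDeriv_zero] using hb s hs 0,
      rapidDecay_fourierHat_of_bound hσ f hp ha⟩
  tfae_have 1 → 3 := fun ⟨_, _, _, h1, h2⟩ => by
    obtain ⟨h3, h4⟩ := decay le_top le_top
      (fun r hr => by simpa only [multiDeriv_zero] using h1 r hr 0)
      (fun r hr => by simpa only [multiDeriv_zero] using h2 r hr 0)
    exact ⟨fun r hr => h3.eLpNorm_exp_mul_lt_top hω hp hr,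
      fun r hr => h4.eLpNorm_exp_mul_lt_top hσ hq hr⟩
  tfae_have 3 → 4 := fun h => by
    obtain ⟨h1, h2⟩ := decay hp hq h.1 h.2
    simp only [mul_assoc]
    exact ⟨fun r hr α => (h1.monomialFun_mul hω α).eLpNorm_exp_mul_lt_top hω hp hr,
      fun r hr α => (h2.monomialFun_mul hσ α).eLpNorm_exp_mul_lt_top hσ hq hr⟩
  tfae_have 4 → 2 := fun h => by
    obtain ⟨h1, h2⟩ := decay hp hq
      (fun r hr => by simpa only [mono_zero, Complex.ofReal_one, mul_one] using h.1 r hr 0)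
      (fun r hr => by simpa only [mono_zero, Complex.ofReal_one, mul_one] using h.2 r hr 0)
    rw [← hg] at h2 ⊢
    exact ⟨fun r hr α => (h1.multiDeriv_schwartzMap hω α).eLpNorm_exp_mul_lt_top hω hp hr,
      fun r hr α => (h2.multiDeriv_schwartzMap hσ α).eLpNorm_exp_mul_lt_top hσ hq hr⟩
  tfae_have 2 → 6 := fun h => by
    have h1 := decay hp hq
      (fun r hr => by simpa only [multiDeriv_zero] using h.1 r hr 0)
      (fun r hr => by simpa only [multiDeriv_zero] using h.2 r hr 0)
    simp only [expE_sub_eq_youngFactor_mul]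
    exact mixed h1 hp
  tfae_have 6 → 5 := fun h => by
    simp only [expE_sub_eq_youngFactor_mul] at h
    -- (6) only involves p, whereas (5b) is in L^q: rapid decay is extracted with p in both places,
    -- then the mixed bound is applied again with q.
    have h1 := separate hp hp
      (fun r hr β => bound_deriv_of_mixed_bound hω f (fun s hs => h r s hr hs) β)
      (fun s hs α => bound_mul_of_mixed_bound hσ f (fun r hr => h r s hr hs) α)
    exact ⟨fun r hr β => bound_deriv_of_mixed_bound hω f (fun s hs => mixed h1 hp r s hr hs) β,
      fun s hs α => bound_mul_of_mixed_bound hσ f (fun r hr => mixed h1 hq r s hr hs) α⟩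
  tfae_have 5 → 1 := fun h => by
    obtain ⟨h1, h2⟩ := separate hp hq h.1 h.2
    exact mem_ultraSpace_of_rapidDecay hω hσ h1 h2
  tfae_finish
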